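/- Let $K$ be a field, $S$ an inverse monoid, $A$ a unital associative $K$-algebra, and let $\theta$ be a unital action of $S$ on $A$: a homomorphism $s\mapsto\theta_s$ from $S$ to the monoid of partial bijections of $A$ with $\theta_1=\mathrm{id}_A$ such that, for every $s\in S$, there is a central idempotent $1_s\in A$ with $\operatorname{ran}\theta_s=1_sA$ (so that $\operatorname{dom}\theta_s=1_{s^{-1}}A$) and $\theta_s:1_{s^{-1}}A\to 1_sA$ is an isomorphism of $K$-algebras. Let $L=\bigoplus_{s\in S}1_sA\,\delta_s$ with the product $a\delta_s\cdot b\delta_t=a\,\theta_s(1_{s^{-1}}b)\,\delta_{st}$, let $\mathcal N$ be the two-sided ideal of $L$ generated by all $a\delta_s-a\delta_t$ with $a\in 1_sA$ and $s\le t$ (the natural partial order), and let $\Lambda=A\rtimes_\theta S=L/\mathcal N$ be the crossed product; write $\overline{w}$ for the class of $w\in L$. For a $K$-algebra $R$ put $R^e=R\otimes_K R^{\mathrm{op}}$ and identify $R$-bimodules with left $R^e$-modules. Every $\Lambda$-bimodule $M$ is an $A$-bimodule via $a\mapsto\overline{a\delta_1}$, and $\operatorname{Hom}_{A^e}(A,M)$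 is a left $KS$-module via $$(s\cdot f)(a)=\overline{1_s\delta_s}\; f\bigl(\theta_{s^{-1}}(1_s a)\bigr)\;\overline{1_{s^{-1}}\delta_{s^{-1}}}.$$ This defines a left exact functor $T_1=\operatorname{Hom}_{A^e}(A,-)$ from $\Lambda^e$-modules to left $KS$-modules; let $R^qT_1$ be its right derived functors. Let $KE(S)$ be the free $K$-module on the set $E(S)$ of idempotents of $S$, with the left $KS$-module structure $s\cdot e=ses^{-1}$. For a left $KS$-module $V$ put $H^p(S,V)=\operatorname{Ext}^p_{KS}(KE(S),V)$, and let $H^n(\Lambda,M)=\operatorname{Ext}^n_{\Lambda^e}(\Lambda,M)$ be Hochschild cohomology. Then for every $\Lambda$-bimodule $M$ there exists a cohomological spectral sequence of $K$-modules $(E_r^{p,q},d_r)_{r\ge 2}$, with $d_r$ of bidegree $(r,1-r)$ and concentrated in $p,q\ge 0$ (a "third quadrant" spectral sequence after the re-indexing $E_{-p,-q}=E^{p,q}$), such that $$E_2^{p,q}\cong H^p\bigl(S,(R^qT_1)M\bigr)\Longrightarrow H^{p+q}(A\rtimes_\theta S,M).$$ That is, for every $n\ge 0$ the $K$-module $H^n(A\rtimes_\theta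 S,M)$ has a decreasing filtration $H^n=F^0\supseteq F^1\supseteq\dots\supseteq F^{n+1}=0$ with $F^p/F^{p+1}\cong E_\infty^{p,q}$ for all $p,q\ge 0$ with $p+q=n$. -/

import Mathlib

open CategoryTheory TensorProduct MulOpposite
open scoped ModuleCat

universe u

/-- An inverse monoid: every `s` has a unique `s⁻¹` with `s s⁻¹ s = s` and `s⁻¹ s s⁻¹ = s⁻¹`. -/
class InverseMonoid (S : Type*) extends Monoid S, Inv S where
  mul_inv_mul (s : S) : s * s⁻¹ * s = s
  inv_mul_inv (s : S) : s⁻¹ * s * s⁻¹ = s⁻¹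
  inv_unique (s t : S) : s * t * s = s → t * s * t = t → t = s⁻¹

namespace InverseMonoid

section Basic

variable {S : Type*} [InverseMonoid S]

theorem inv_inv' (s : S) : s⁻¹⁻¹ = s :=
  (inv_unique s⁻¹ s (inv_mul_inv s) (mul_inv_mul s)).symm

theorem inv_of_idem {e : S} (he : e * e = e) : e⁻¹ = e :=
  (inv_unique e e (by rw [he, he]) (by rw [he, he])).symm

theorem one_inv : (1 : S)⁻¹ = 1 := inv_of_idem (mul_one 1)

theorem idem_mul {e f : S} (he : e * e = e) (hf : f * f = f) : (e * f) * (e * f) = e * f := by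
  have h1 := mul_inv_mul (e * f)
  have h2 := inv_mul_inv (e * f)
  generalize hx : (e * f)⁻¹ = x at h1 h2
  have hy : f * x * e = x := by
    rw [← hx]
    apply inv_unique
    · rw [hx]
      calc e * f * (f * x * e) * (e * f) = e * (f * f) * x * (e * e) * f := by
            simp only [mul_assoc]
        _ = e * f * x * (e * f) := by rw [he, hf]; simp only [mul_assoc]
        _ = _ := h1
    · rw [hx]
      calc f * x * e * (e * f) * (f * x * e) = f * (x * ((e * e) * (f * f)) * x) * e := by
            simp only [mul_assoc]
        _ = _ := by rw [he, hf, h2]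
  have hidem : x * x = x := by
    calc x * x = (f * x * e) * (f * x * e) := by rw [hy]
      _ = f * (x * (e * f) * x) * e := by simp only [mul_assoc]
      _ = x := by rw [h2, hy]
  have h3 : e * f = x⁻¹ := by rw [← hx, inv_inv']
  rw [h3, inv_of_idem hidem, hidem]

theorem idem_comm {e f : S} (he : e * e = e) (hf : f * f = f) : e * f = f * e := by
  have hef := idem_mul he hf
  have hfe := idem_mul hf he
  have h : f * e = (e * f)⁻¹ := by
    apply inv_unique
    · calc e * f * (f * e) * (e * f) = e * (f * f) * (e * e) * f := by simp only [mul_assoc]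
        _ = e * f * (e * f) := by rw [he, hf]; simp only [mul_assoc]
        _ = _ := hef
    · calc f * e * (e * f) * (f * e) = f * (e * e) * (f * f) * e := by simp only [mul_assoc]
        _ = f * e * (f * e) := by rw [he, hf]; simp only [mul_assoc]
        _ = _ := hfe
  rw [h, inv_of_idem hef]

theorem mul_inv_idem (s : S) : (s * s⁻¹) * (s * s⁻¹) = s * s⁻¹ := by
  rw [← mul_assoc, mul_inv_mul]

theorem inv_mul_idem (s : S) : (s⁻¹ * s) * (s⁻¹ * s) = s⁻¹ * s := by
  rw [← mul_assoc, inv_mul_inv]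

theorem mul_inv_rev' (s t : S) : (s * t)⁻¹ = t⁻¹ * s⁻¹ := by
  have hc := idem_comm (mul_inv_idem t) (inv_mul_idem s)
  symm
  apply inv_unique
  · calc s * t * (t⁻¹ * s⁻¹) * (s * t) = s * ((t * t⁻¹) * (s⁻¹ * s)) * t := by
          simp only [mul_assoc]
      _ = (s * s⁻¹ * s) * (t * t⁻¹ * t) := by rw [hc]; simp only [mul_assoc]
      _ = _ := by rw [mul_inv_mul, mul_inv_mul]
  · calc t⁻¹ * s⁻¹ * (s * t) * (t⁻¹ * s⁻¹) = t⁻¹ * ((s⁻¹ * s) * (t * t⁻¹)) * s⁻¹ := by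
          simp only [mul_assoc]
      _ = (t⁻¹ * t * t⁻¹) * (s⁻¹ * s * s⁻¹) := by rw [← hc]; simp only [mul_assoc]
      _ = _ := by rw [inv_mul_inv, inv_mul_inv]

/-- The natural partial order: `s ≤ t` iff `s = e t` for some idempotent `e`. -/
def NatLE (s t : S) : Prop := ∃ e : S, IsIdempotentElem e ∧ s = e * t

variable (S) in
/-- The set `E(S)` of idempotents of `S`. -/
def Idem : Type _ := {e : S // IsIdempotentElem e}

/-- `S` acts on `E(S)` by `s · e = s e s⁻¹`. -/
instance : MulAction S (Idem S) where
  smul s e := ⟨s * e.1 * s⁻¹, by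
    have he : e.1 * e.1 = e.1 := e.2
    change (s * e.1 * s⁻¹) * (s * e.1 * s⁻¹) = s * e.1 * s⁻¹
    calc (s * e.1 * s⁻¹) * (s * e.1 * s⁻¹) = s * (e.1 * (s⁻¹ * s)) * e.1 * s⁻¹ := by
          simp only [mul_assoc]
      _ = (s * s⁻¹ * s) * (e.1 * e.1) * s⁻¹ := by
          rw [idem_comm he (inv_mul_idem s)]; simp only [mul_assoc]
      _ = _ := by rw [mul_inv_mul, he]⟩
  one_smul e := Subtype.ext (by
    change 1 * e.1 * (1 : S)⁻¹ = e.1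
    rw [one_inv, one_mul, mul_one])
  mul_smul s t e := Subtype.ext (by
    change s * t * e.1 * (s * t)⁻¹ = s * (t * e.1 * t⁻¹) * s⁻¹
    rw [mul_inv_rev']; simp only [mul_assoc])

end Basic

/-- The trivial left `KS`-module `KE(S)`: the free `K`-module on `E(S)` with `s · e = s e s⁻¹`. -/
noncomputable def trivialModule (K S : Type u) [CommRing K] [InverseMonoid S] :
    ModuleCat.{u} (MonoidAlgebra K S) :=
  ModuleCat.of (MonoidAlgebra K S) (Representation.ofMulAction K S (Idem S)).asModule

/-- The cohomology `Hⁿ(S, V) = Extⁿ_{KS}(KE(S), V)` of an inverse monoid. -/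
noncomputable def cohomology {K S : Type u} [Field K] [InverseMonoid S]
    (V : ModuleCat.{u} (MonoidAlgebra K S)) (n : ℕ) : ModuleCat.{u} K :=
  ModuleCat.of K (Abelian.Ext (trivialModule K S) V n)

end InverseMonoid

/-- The enveloping algebra `Rᵉ = R ⊗ Rᵒᵖ`; left `Rᵉ`-modules are `R`-bimodules through
`(a ⊗ b) · x = a x b`. -/
abbrev Envelope (K R : Type*) [CommRing K] [Ring R] [Algebra K R] : Type _ := R ⊗[K] Rᵐᵒᵖ

/-- `R` as a left `Rᵉ`-module (that is, as an `R`-bimodule), `(a ⊗ b) · x = a x b`. -/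
noncomputable def regularBimodule (K R : Type u) [CommRing K] [Ring R] [Algebra K R] :
    ModuleCat.{u} (Envelope K R) :=
  letI : Module (Envelope K R) R := instModuleTensorProductMop K R
  ModuleCat.of (Envelope K R) R

/-- The Hochschild cohomology `Hⁿ(R, M) = Extⁿ_{Rᵉ}(R, M)` of an algebra over a field. -/
noncomputable def hochschildCohomology {K R : Type u} [Field K] [Ring R] [Algebra K R]
    (M : ModuleCat.{u} (Envelope K R)) (n : ℕ) : ModuleCat.{u} K :=
  ModuleCat.of K (Abelian.Ext (regularBimodule K R) M n)

/-- A unital action of an inverse monoid `S` on a `K`-algebra `A`: a homomorphism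
`s ↦ θ_s` from `S` to the symmetric inverse monoid of partial bijections of `A`, with
`θ_1 = id`, such that the range of `θ_s` is the ideal `1_s A` for a central idempotent `1_s`
(hence the domain, which is the range of `θ_{s⁻¹}`, is `1_{s⁻¹} A`), and `θ_s` is an
isomorphism of (non-unital) algebras from its domain to its range. -/
structure UnitalAction (K S A : Type*) [CommRing K] [InverseMonoid S] [Ring A] [Algebra K A] where
  /-- the partial bijection `θ_s`; `b ∈ θ s a` means that `a ∈ dom θ_s` and `θ_s(a) = b` -/
  pequiv : S → (A ≃. A)
  map_one : pequiv 1 = PEquiv.refl A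
  map_mul (s t : S) : pequiv (s * t) = (pequiv t).trans (pequiv s)
  /-- the central idempotent `1_s` -/
  unit : S → A
  unit_idem (s : S) : unit s * unit s = unit s
  unit_central (s : S) (a : A) : unit s * a = a * unit s
  range_eq (s : S) (b : A) : (∃ a, b ∈ pequiv s a) ↔ ∃ c, b = unit s * c
  add_mem {s : S} {a a' b b' : A} :
    b ∈ pequiv s a → b' ∈ pequiv s a' → b + b' ∈ pequiv s (a + a')
  mul_mem {s : S} {a a' b b' : A} :
    b ∈ pequiv s a → b' ∈ pequiv s a' → b * b' ∈ pequiv s (a * a')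
  smul_mem (r : K) {s : S} {a b : A} : b ∈ pequiv s a → r • b ∈ pequiv s (r • a)

namespace UnitalAction

open InverseMonoid

section Action

variable {K S A : Type*} [CommRing K] [InverseMonoid S] [Ring A] [Algebra K A]
variable (θ : UnitalAction K S A)

theorem range_iff (s : S) (b : A) : (∃ a, b ∈ θ.pequiv s a) ↔ θ.unit s * b = b := by
  rw [θ.range_eq]
  constructor
  · rintro ⟨c, rfl⟩; rw [← mul_assoc, θ.unit_idem]
  · intro h; exact ⟨b, h.symm⟩

theorem comp_mem {s t : S} {a b c : A} (hb : b ∈ θ.pequiv t a) (hc : c ∈ θ.pequiv s b) :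
    c ∈ θ.pequiv (s * t) a := by
  rw [θ.map_mul, PEquiv.mem_trans]; exact ⟨b, hb, hc⟩

theorem mem_inv {s : S} {a b : A} (h : b ∈ θ.pequiv s a) : a ∈ θ.pequiv s⁻¹ b := by
  have h1 : b ∈ θ.pequiv (s * s⁻¹ * s) a := by rw [mul_inv_mul]; exact h
  rw [θ.map_mul, PEquiv.mem_trans] at h1
  obtain ⟨b1, hb1, h2⟩ := h1
  obtain rfl : b1 = b := Option.mem_unique hb1 h
  rw [θ.map_mul, PEquiv.mem_trans] at h2
  obtain ⟨a', ha', h3⟩ := h2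
  obtain rfl : a' = a := (θ.pequiv s).inj h3 h
  exact ha'

theorem dom_iff (s : S) (a : A) : (∃ b, b ∈ θ.pequiv s a) ↔ θ.unit s⁻¹ * a = a := by
  rw [← θ.range_iff]
  constructor
  · rintro ⟨b, h⟩; exact ⟨b, θ.mem_inv h⟩
  · rintro ⟨b, h⟩
    refine ⟨b, ?_⟩
    have := θ.mem_inv h
    rwa [inv_inv'] at this

theorem unit_one : θ.unit 1 = 1 := by
  have h : ∃ a, (1 : A) ∈ θ.pequiv 1 a := ⟨1, by rw [θ.map_one]; rfl⟩
  simpa using (θ.range_iff 1 1).1 h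

/-- The total operation `s · a = θ_s(1_{s⁻¹} a)`; the default value `0` is never used, because
`1_{s⁻¹} a` always lies in the domain of `θ_s`. -/
noncomputable def act (s : S) (a : A) : A := (θ.pequiv s (θ.unit s⁻¹ * a)).getD 0

theorem act_mem (s : S) (a : A) : θ.act s a ∈ θ.pequiv s (θ.unit s⁻¹ * a) := by
  have h : ∃ b, b ∈ θ.pequiv s (θ.unit s⁻¹ * a) :=
    (θ.dom_iff s _).2 (by rw [← mul_assoc, θ.unit_idem])
  obtain ⟨b, hb⟩ := h
  have hb' : θ.pequiv s (θ.unit s⁻¹ * a) = some b := hb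
  have : θ.act s a = b := by rw [act, hb']; rfl
  rw [this]; exact hb

theorem act_eq {s : S} {a b : A} (h : b ∈ θ.pequiv s (θ.unit s⁻¹ * a)) : θ.act s a = b :=
  Option.mem_unique (θ.act_mem s a) h

theorem unit_mul_act (s : S) (a : A) : θ.unit s * θ.act s a = θ.act s a :=
  (θ.range_iff s _).1 ⟨_, θ.act_mem s a⟩

theorem act_add (s : S) (a b : A) : θ.act s (a + b) = θ.act s a + θ.act s b :=
  θ.act_eq (by rw [mul_add]; exact θ.add_mem (θ.act_mem s a) (θ.act_mem s b))

theorem act_smul (s : S) (r : K) (a : A) : θ.act s (r • a) = r • θ.act s a :=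
  θ.act_eq (by rw [mul_smul_comm]; exact θ.smul_mem r (θ.act_mem s a))

theorem act_zero (s : S) : θ.act s 0 = 0 := by
  have := θ.act_add s 0 0
  simpa using this

theorem act_mul (s : S) (a b : A) : θ.act s (a * b) = θ.act s a * θ.act s b := by
  apply θ.act_eq
  have h : θ.unit s⁻¹ * (a * b) = (θ.unit s⁻¹ * a) * (θ.unit s⁻¹ * b) := by
    rw [mul_assoc (θ.unit s⁻¹) a, ← mul_assoc a (θ.unit s⁻¹) b, ← θ.unit_central s⁻¹ a,
      mul_assoc (θ.unit s⁻¹) a b, ← mul_assoc (θ.unit s⁻¹) (θ.unit s⁻¹), θ.unit_idem]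
  rw [h]
  exact θ.mul_mem (θ.act_mem s a) (θ.act_mem s b)

theorem act_one (a : A) : θ.act 1 a = a := by
  apply θ.act_eq
  rw [one_inv, θ.unit_one, one_mul, θ.map_one]; rfl

theorem act_comp (s t : S) (a : A) : θ.act (s * t) a = θ.act s (θ.act t a) := by
  apply θ.act_eq
  set d := θ.unit (s * t)⁻¹ with hd
  have hb := θ.act_mem t a
  set b := θ.act t a with hbdef
  have hs := θ.act_mem s b
  have hran : ∃ a', (θ.unit s⁻¹ * b) ∈ θ.pequiv t a' := by
    rw [θ.range_iff, ← mul_assoc, θ.unit_central t (θ.unit s⁻¹), mul_assoc, hbdef,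
      θ.unit_mul_act]
  obtain ⟨a', ha'⟩ := hran
  have hda' : d * a' = a' := (θ.dom_iff (s * t) a').1 ⟨_, θ.comp_mem ha' hs⟩
  obtain ⟨x, hx⟩ := (θ.dom_iff (s * t) d).2 (θ.unit_idem _)
  rw [θ.map_mul, PEquiv.mem_trans] at hx
  obtain ⟨y, hy, hyx⟩ := hx
  have hsy : θ.unit s⁻¹ * y = y := (θ.dom_iff s y).1 ⟨_, hyx⟩
  have htd : θ.unit t⁻¹ * d = d := (θ.dom_iff t d).1 ⟨_, hy⟩
  have e1 : y * (θ.unit s⁻¹ * b) = θ.unit s⁻¹ * b :=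
    Option.mem_unique (by have := θ.mul_mem hy ha'; rwa [hda'] at this) ha'
  have e2 : y * b = θ.unit s⁻¹ * b := by
    rw [← e1, ← mul_assoc, ← θ.unit_central, hsy]
  have e3 : θ.unit s⁻¹ * b ∈ θ.pequiv t (d * a) := by
    have := θ.mul_mem hy hb
    rwa [e2, ← mul_assoc, ← θ.unit_central t⁻¹ d, htd] at this
  exact θ.comp_mem e3 hs

theorem act_act_inv (s : S) (a : A) : θ.act s (θ.act s⁻¹ a) = θ.unit s * a := by
  have h := θ.mem_inv (θ.act_mem s⁻¹ a)
  rw [inv_inv'] at h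
  apply θ.act_eq
  rw [θ.unit_mul_act]; exact h

theorem act_unit (s : S) : θ.act s 1 = θ.unit s := by
  have h1 : θ.act s 1 * θ.unit s = θ.unit s := by
    have h2 : θ.unit s = θ.act s (θ.act s⁻¹ 1) := by rw [act_act_inv, mul_one]
    calc θ.act s 1 * θ.unit s = θ.act s 1 * θ.act s (θ.act s⁻¹ 1) := by rw [← h2]
      _ = θ.unit s := by rw [← θ.act_mul, one_mul, ← h2]
  rw [← h1, ← θ.unit_central, θ.unit_mul_act]

theorem unit_mul_of_mem {s t : S} {a b : A} (hb : θ.unit t * b = b) :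
    θ.unit (s * t) * (a * θ.act s b) = a * θ.act s b := by
  have h : θ.act s b = θ.act (s * t) (θ.act t⁻¹ b) := by
    rw [act_comp, act_act_inv, hb]
  rw [← mul_assoc, θ.unit_central, mul_assoc, h, θ.unit_mul_act]

/-- The product `(a δ_s)(b δ_t) = a θ_s(1_{s⁻¹} b) δ_{st}`, extended bilinearly. -/
noncomputable def mulAux : (S →₀ A) →ₗ[K] (S →₀ A) →ₗ[K] (S →₀ A) :=
  LinearMap.mk₂ K
    (fun f g => f.sum fun s a => g.sum fun t b => Finsupp.single (s * t) (a * θ.act s b))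
    (fun f f' g => by
      apply Finsupp.sum_add_index'
      · intro s; simp
      · intro s a a'
        rw [← Finsupp.sum_add]
        simp only [add_mul, Finsupp.single_add])
    (fun r f g => by
      rw [Finsupp.sum_smul_index' (by intro s; simp), Finsupp.smul_sum]
      simp only [Finsupp.smul_sum, Finsupp.smul_single, smul_mul_assoc])
    (fun f g g' => by
      rw [← Finsupp.sum_add]
      congr 1; ext1 s; ext1 a
      apply Finsupp.sum_add_index'
      · intro t; simp [act_zero]
      · intro t b b'; rw [act_add, mul_add, Finsupp.single_add])
    (fun r f g => by
      rw [Finsupp.smul_sum]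
      congr 1; ext1 s; ext1 a
      rw [Finsupp.sum_smul_index' (by intro t; simp [act_zero]), Finsupp.smul_sum]
      simp only [act_smul, mul_smul_comm, Finsupp.smul_single])

theorem mulAux_single (s t : S) (a b : A) :
    θ.mulAux (Finsupp.single s a) (Finsupp.single t b) =
      Finsupp.single (s * t) (a * θ.act s b) := by
  simp [mulAux, act_zero]

theorem mulAux_assoc (f g h : S →₀ A) :
    θ.mulAux (θ.mulAux f g) h = θ.mulAux f (θ.mulAux g h) := by
  induction f using Finsupp.induction_linear with
  | zero => simp
  | add f f' hf hf' => simp only [_root_.map_add, LinearMap.add_apply, hf, hf']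
  | single s a =>
    induction g using Finsupp.induction_linear with
    | zero => simp
    | add g g' hg hg' => simp only [_root_.map_add, LinearMap.add_apply, hg, hg']
    | single t b =>
      induction h using Finsupp.induction_linear with
      | zero => simp
      | add h h' hh hh' => simp only [_root_.map_add, hh, hh']
      | single v c =>
        simp only [mulAux_single, act_mul, act_comp, mul_assoc]

theorem one_mulAux (f : S →₀ A) : θ.mulAux (Finsupp.single 1 1) f = f := by
  induction f using Finsupp.induction_linear with
  | zero => simp
  | add f f' hf hf' => simp only [_root_.map_add, hf, hf']
  | single s a => rw [mulAux_single, act_one, one_mul, one_mul]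

/-- The `K`-module `L(A, θ, S) = ⨁_{s ∈ S} 1_s A δ_s`: the finitely supported `f : S → A` with
`f s ∈ 1_s A` for all `s`. -/
noncomputable def skewSum : Submodule K (S →₀ A) where
  carrier := {f | ∀ s, θ.unit s * f s = f s}
  add_mem' hf hg s := by rw [Finsupp.add_apply, mul_add, hf s, hg s]
  zero_mem' s := by simp
  smul_mem' r f hf s := by rw [Finsupp.smul_apply, mul_smul_comm, hf s]

theorem single_mem {s : S} {a : A} (h : θ.unit s * a = a) :
    Finsupp.single s a ∈ θ.skewSum := by
  classical
  intro t
  rw [Finsupp.single_apply]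
  split_ifs with hst
  · subst hst; exact h
  · simp

theorem mulAux_mem {f g : S →₀ A} (hg : g ∈ θ.skewSum) :
    θ.mulAux f g ∈ θ.skewSum := by
  change (f.sum fun s a => g.sum fun t b => Finsupp.single (s * t) (a * θ.act s b)) ∈ _
  apply Submodule.sum_mem
  intro s _
  apply Submodule.sum_mem
  intro t _
  exact θ.single_mem (θ.unit_mul_of_mem (hg t))

theorem mulAux_one {f : S →₀ A} (hf : f ∈ θ.skewSum) :
    θ.mulAux f (Finsupp.single 1 1) = f := by
  change (f.sum fun s a => (Finsupp.single (1 : S) (1 : A)).sum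
    fun t b => Finsupp.single (s * t) (a * θ.act s b)) = f
  conv_rhs => rw [← Finsupp.sum_single f]
  apply Finsupp.sum_congr
  intro s _
  rw [Finsupp.sum_single_index (by simp [act_zero]), mul_one, act_unit, ← θ.unit_central, hf s]

noncomputable instance : Ring θ.skewSum where
  __ := (inferInstance : AddCommGroup θ.skewSum)
  mul f g := ⟨θ.mulAux f.1 g.1, θ.mulAux_mem g.2⟩
  one := ⟨Finsupp.single 1 1, θ.single_mem (by rw [θ.unit_one, mul_one])⟩
  mul_assoc f g h := Subtype.ext (θ.mulAux_assoc f.1 g.1 h.1)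
  one_mul f := Subtype.ext (θ.one_mulAux f.1)
  mul_one f := Subtype.ext (θ.mulAux_one f.2)
  left_distrib f g h := Subtype.ext ((θ.mulAux f.1).map_add g.1 h.1)
  right_distrib f g h := Subtype.ext (θ.mulAux.map_add₂ f.1 g.1 h.1)
  zero_mul f := Subtype.ext (θ.mulAux.map_zero₂ f.1)
  mul_zero f := Subtype.ext ((θ.mulAux f.1).map_zero)

noncomputable instance : Algebra K θ.skewSum :=
  Algebra.ofModule
    (fun r f g => Subtype.ext (θ.mulAux.map_smul₂ r f.1 g.1))
    (fun r f g => Subtype.ext ((θ.mulAux f.1).map_smul r g.1))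

/-- The two-sided ideal `𝒩` of `L(A, θ, S)` generated by the elements `a δ_s - a δ_t` with
`a ∈ 1_s A` and `s ≤ t`. -/
noncomputable def ideal : TwoSidedIdeal θ.skewSum :=
  TwoSidedIdeal.span {x | ∃ (s t : S) (a : A), NatLE s t ∧ θ.unit s * a = a ∧
    (x : S →₀ A) = Finsupp.single s a - Finsupp.single t a}

/-- The crossed product `A ⋊_θ S = L(A, θ, S) / 𝒩`. -/
def CrossedProduct : Type _ := θ.ideal.ringCon.Quotient

noncomputable instance : Ring θ.CrossedProduct :=
  inferInstanceAs (Ring θ.ideal.ringCon.Quotient)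

noncomputable instance : Algebra K θ.CrossedProduct :=
  inferInstanceAs (Algebra K θ.ideal.ringCon.Quotient)

/-- The quotient map `L(A, θ, S) → A ⋊_θ S`. -/
noncomputable def quot : θ.skewSum →ₐ[K] θ.CrossedProduct :=
  RingCon.mkₐ (α := K) θ.ideal.ringCon

/-- The algebra homomorphism `A → L(A, θ, S)`, `a ↦ a δ_1`. -/
noncomputable def inclL : A →ₐ[K] θ.skewSum :=
  AlgHom.ofLinearMap
    { toFun a := ⟨Finsupp.single 1 a, θ.single_mem (by rw [θ.unit_one, one_mul])⟩
      map_add' a b := Subtype.ext (Finsupp.single_add _ _ _)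
      map_smul' r a := Subtype.ext (Finsupp.smul_single r _ _).symm }
    rfl
    (fun a b => Subtype.ext (by
      change Finsupp.single 1 (a * b) = θ.mulAux (Finsupp.single 1 a) (Finsupp.single 1 b)
      rw [mulAux_single, act_one, mul_one]))

/-- The monoid homomorphism `S → L(A, θ, S)`, `s ↦ 1_s δ_s`. -/
noncomputable def deltaL : S →* θ.skewSum where
  toFun s := ⟨Finsupp.single s (θ.unit s), θ.single_mem (θ.unit_idem s)⟩
  map_one' := Subtype.ext (by
    change Finsupp.single 1 (θ.unit 1) = Finsupp.single 1 1
    rw [θ.unit_one])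
  map_mul' s t := Subtype.ext (by
    change Finsupp.single (s * t) (θ.unit (s * t)) =
      θ.mulAux (Finsupp.single s (θ.unit s)) (Finsupp.single t (θ.unit t))
    rw [mulAux_single, ← θ.act_unit t, ← act_comp, act_unit, ← θ.act_unit (s * t), act_comp,
      unit_mul_act])

theorem deltaL_mul_inclL (s : S) (a : A) :
    θ.deltaL s * θ.inclL a = θ.inclL (θ.act s a) * θ.deltaL s := Subtype.ext (by
  change θ.mulAux (Finsupp.single s (θ.unit s)) (Finsupp.single 1 a) =
    θ.mulAux (Finsupp.single 1 (θ.act s a)) (Finsupp.single s (θ.unit s))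
  rw [mulAux_single, mulAux_single, mul_one, one_mul, act_one, θ.unit_central])

theorem inclL_unit_mul (s : S) (a : A) :
    θ.inclL (θ.unit s * a) * θ.deltaL s = θ.inclL a * θ.deltaL s := Subtype.ext (by
  change θ.mulAux (Finsupp.single 1 (θ.unit s * a)) (Finsupp.single s (θ.unit s)) =
    θ.mulAux (Finsupp.single 1 a) (Finsupp.single s (θ.unit s))
  rw [mulAux_single, mulAux_single, act_one, θ.unit_central s a, mul_assoc, θ.unit_idem])

/-- The algebra homomorphism `A → A ⋊_θ S`, `a ↦ a δ_1 + 𝒩`. -/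
noncomputable def incl : A →ₐ[K] θ.CrossedProduct := θ.quot.comp θ.inclL

/-- The monoid homomorphism `S → A ⋊_θ S`, `s ↦ 1_s δ_s + 𝒩`. -/
noncomputable def delta : S →* θ.CrossedProduct :=
  (θ.quot : θ.skewSum →* θ.CrossedProduct).comp θ.deltaL

theorem delta_mul_incl (s : S) (a : A) :
    θ.delta s * θ.incl a = θ.incl (θ.act s a) * θ.delta s := by
  have := congrArg θ.quot (θ.deltaL_mul_inclL s a)
  rw [_root_.map_mul, _root_.map_mul] at this
  exact this

theorem incl_unit_mul (s : S) (a : A) :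
    θ.incl (θ.unit s * a) * θ.delta s = θ.incl a * θ.delta s := by
  have := congrArg θ.quot (θ.inclL_unit_mul s a)
  rw [_root_.map_mul θ.quot, _root_.map_mul θ.quot] at this
  exact this

/-- The algebra homomorphism `Aᵉ → (A ⋊_θ S)ᵉ` induced by `A → A ⋊_θ S`. -/
noncomputable def envIncl : Envelope K A →ₐ[K] Envelope K θ.CrossedProduct :=
  Algebra.TensorProduct.map θ.incl (AlgHom.op θ.incl)

/-- The element of `(A ⋊_θ S)ᵉ` acting on bimodules by
`s · x = (1_s δ_s) x (1_{s⁻¹} δ_{s⁻¹})`. -/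
noncomputable def conj : S →* Envelope K θ.CrossedProduct where
  toFun s := θ.delta s ⊗ₜ op (θ.delta s⁻¹)
  map_one' := by rw [one_inv, _root_.map_one]; rfl
  map_mul' s t := by
    rw [Algebra.TensorProduct.tmul_mul_tmul, mul_inv_rev', _root_.map_mul, _root_.map_mul, op_mul]

end Action

section Functor

attribute [local instance] instModuleTensorProductMop

variable {K S A : Type*} [Field K] [InverseMonoid S] [Ring A] [Algebra K A]
variable (θ : UnitalAction K S A)
variable (M : Type*) [AddCommGroup M] [Module (Envelope K θ.CrossedProduct) M]

/-- `Hom_{Aᵉ}(A, M)` for an `A ⋊_θ S`-bimodule `M`, where `Aᵉ` acts on `M` through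
`Aᵉ → (A ⋊_θ S)ᵉ`: the additive maps `f : A → M` with `f (x • a) = x • f a` for `x ∈ Aᵉ`. -/
abbrev HomAe : Type _ := A →ₛₗ[(θ.envIncl : Envelope K A →+* Envelope K θ.CrossedProduct)] M

variable {M}

theorem conj_envIncl_smul (s : S) (x : Envelope K A) (a : A) (f : θ.HomAe M) :
    θ.conj s • f (θ.act s⁻¹ (x • a)) = θ.envIncl x • θ.conj s • f (θ.act s⁻¹ a) := by
  induction x using TensorProduct.induction_on with
  | zero =>
    have h0 : (0 : Envelope K A) • a = 0 := zero_smul (Envelope K A) a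
    have h1 : θ.conj s • f (θ.act s⁻¹ ((0 : Envelope K A) • a)) = 0 := by
      rw [h0, act_zero, _root_.map_zero, smul_zero]
    have h2 : θ.envIncl (0 : Envelope K A) • θ.conj s • f (θ.act s⁻¹ a) = 0 := by
      rw [_root_.map_zero]
      exact zero_smul (Envelope K θ.CrossedProduct) (θ.conj s • f (θ.act s⁻¹ a))
    exact h1.trans h2.symm
  | add x y hx hy =>
    rw [add_smul, act_add, _root_.map_add, smul_add, hx, hy, _root_.map_add, add_smul]
  | tmul b c =>
    have h1 : (b ⊗ₜ[K] c : Envelope K A) • a = b * (a * c.unop) := rfl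
    have h2 : θ.act s⁻¹ ((b ⊗ₜ[K] c : Envelope K A) • a) =
        ((θ.act s⁻¹ b) ⊗ₜ[K] op (θ.act s⁻¹ c.unop) : Envelope K A) • θ.act s⁻¹ a := by
      rw [h1, act_mul, act_mul]; rfl
    rw [h2, LinearMap.map_smulₛₗ, smul_smul, smul_smul]
    congr 1
    change (θ.delta s ⊗ₜ[K] op (θ.delta s⁻¹)) *
        (θ.incl (θ.act s⁻¹ b) ⊗ₜ[K] op (θ.incl (θ.act s⁻¹ c.unop))) =
      (θ.incl b ⊗ₜ[K] op (θ.incl c.unop)) * (θ.delta s ⊗ₜ[K] op (θ.delta s⁻¹))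
    rw [Algebra.TensorProduct.tmul_mul_tmul, Algebra.TensorProduct.tmul_mul_tmul,
      ← op_mul, ← op_mul, delta_mul_incl, act_act_inv, incl_unit_mul, delta_mul_incl]

variable [Module K M] [IsScalarTower K (Envelope K θ.CrossedProduct) M]

variable (M) in
/-- `Hom_{Aᵉ}(A, M)` as a representation of `S`, with `(s · f)(a) = s · f(s⁻¹ · a)`. -/
noncomputable def homRep : Representation K S (θ.HomAe M) where
  toFun s :=
    { toFun f :=
        { toFun a := θ.conj s • f (θ.act s⁻¹ a)
          map_add' a b := by rw [act_add, _root_.map_add, smul_add]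
          map_smul' x a := θ.conj_envIncl_smul s x a f }
      map_add' f g := LinearMap.ext fun a => smul_add _ _ _
      map_smul' r f := LinearMap.ext fun a => smul_comm _ _ _ }
  map_one' := by
    ext f a
    change θ.conj 1 • f (θ.act 1⁻¹ a) = f a
    rw [one_inv, act_one, _root_.map_one, one_smul]
  map_mul' s t := by
    ext f a
    change θ.conj (s * t) • f (θ.act (s * t)⁻¹ a) =
      θ.conj s • θ.conj t • f (θ.act t⁻¹ (θ.act s⁻¹ a))
    rw [mul_inv_rev', act_comp, _root_.map_mul, mul_smul]

end Functor

section T1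

attribute [local instance] instModuleTensorProductMop

variable {K S A : Type u} [Field K] [InverseMonoid S] [Ring A] [Algebra K A]
variable (θ : UnitalAction K S A)

/-- Composition with a homomorphism `g` of `A ⋊_θ S`-bimodules, as a `K`-linear map. -/
noncomputable def homComp {M N : ModuleCat.{u} (Envelope K θ.CrossedProduct)} (g : M ⟶ N) :
    θ.HomAe M →ₗ[K] θ.HomAe N where
  toFun f := g.hom.comp f
  map_add' f f' := LinearMap.comp_add _ _ _
  map_smul' r f := LinearMap.ext fun a => by
    change g.hom (r • f a) = r • g.hom (f a)
    rw [← algebraMap_smul (Envelope K θ.CrossedProduct) r (f a), g.hom.map_smul, algebraMap_smul]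

theorem homComp_homRep {M N : ModuleCat.{u} (Envelope K θ.CrossedProduct)} (g : M ⟶ N)
    (s : S) (f : θ.HomAe M) :
    θ.homComp g (θ.homRep M s f) = θ.homRep N s (θ.homComp g f) :=
  LinearMap.ext fun _ => g.hom.map_smul _ _

/-- Composition with a homomorphism `g` of `A ⋊_θ S`-bimodules, as a `KS`-linear map. -/
noncomputable def homMap {M N : ModuleCat.{u} (Envelope K θ.CrossedProduct)} (g : M ⟶ N) :
    (θ.homRep M).asModule →ₗ[MonoidAlgebra K S] (θ.homRep N).asModule :=
  MonoidAlgebra.equivariantOfLinearOfComm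
    ((θ.homRep N).asModuleEquiv.symm.toLinearMap ∘ₗ θ.homComp g ∘ₗ
      (θ.homRep M).asModuleEquiv.toLinearMap)
    (fun s f => by
      rw [Representation.single_smul, Representation.single_smul, one_smul, one_smul]
      exact θ.homComp_homRep g s _)

/-- The functor `T₁ = Hom_{Aᵉ}(A, -)` from `(A ⋊_θ S)ᵉ`-modules to left `KS`-modules. -/
noncomputable def T1 :
    ModuleCat.{u} (Envelope K θ.CrossedProduct) ⥤ ModuleCat.{u} (MonoidAlgebra K S) where
  obj M := ModuleCat.of (MonoidAlgebra K S) (θ.homRep M).asModule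
  map g := ModuleCat.ofHom (θ.homMap g)
  map_id _ := rfl
  map_comp _ _ := rfl

instance : θ.T1.Additive where
  map_add := rfl

end T1

end UnitalAction

/-- The module `E_∞^{p,q}` of a first quadrant cohomological spectral sequence. For `r ≥ p + q + 2`
the differentials `d_r` into and out of position `(p, q)` are zero (they would start or end outside
the quadrant), so that the terms `E_r^{p,q}` for these `r` are all isomorphic; the term with
`r = p + q + 2` is taken as `E_∞^{p,q}`. -/
noncomputable def pageInfinity {K : Type u} [Field K]
    (E : E₂CohomologicalSpectralSequenceNat (ModuleCat.{u} K)) (p q : ℕ) : ModuleCat.{u} K :=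
  (E.page ((p : ℤ) + q + 2)).X (p, q)

/-- Convergence `E₂^{p,q} ⇒ H^{p+q}`: every `H^n` has a finite decreasing filtration
`H^n = F^0 ⊇ F^1 ⊇ ⋯ ⊇ F^{n+1} = 0` with `F^p / F^{p+1} ≅ E_∞^{p,q}` whenever `p + q = n`. -/
def ConvergesTo {K : Type u} [Field K]
    (E : E₂CohomologicalSpectralSequenceNat (ModuleCat.{u} K)) (H : ℕ → ModuleCat.{u} K) : Prop :=
  ∀ n : ℕ, ∃ F : ℕ → Submodule K (H n), Antitone F ∧ F 0 = ⊤ ∧ F (n + 1) = ⊥ ∧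
    ∀ p q : ℕ, p + q = n →
      Nonempty ((F p ⧸ (F (p + 1)).submoduleOf (F p)) ≃ₗ[K] pageInfinity E p q)

/-! Write `Λ` for the crossed product. The spectral sequence is the Grothendieck spectral sequence
of `Hom_{KS}(KE(S), T₁ -)`, and it rests on two facts: this composite is naturally `Hom_{Λᵉ}(Λ, -)`,
and `T₁` preserves injective objects.

For the first, evaluation at `1` identifies `T₁ M` with the elements `m` of `M` that commute with
`A`, on which `s` acts by `m ↦ δ_s m δ_{s⁻¹}`. The module `KE(S)` is generated by the idempotent
`1`, and `s · 1 = s s⁻¹ = (s s⁻¹) · 1`. The relations in `𝒩` put `δ_e` in the image of `A` for every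
idempotent `e` (`delta_of_idem`), so the image `m` of the generator satisfies `δ_s m δ_{s⁻¹} = δ_{s
s⁻¹} m`, which amounts to `δ_s m = m δ_s`. Both Hom spaces are therefore the elements of `M` that
commute with all of `Λ` (`trivialModuleHomEquivRegular`).

For the second, `V ↦ Λ ⊗ V`, the tensor product being over the algebra of the idempotents of `S` and
`S` acting diagonally on the left, behaves as a left adjoint of `T₁`. That algebra is commutative
and von Neumann regular, so `Λ` is flat over it and `Λ ⊗ -` preserves injections
(`indMap_injective`). A map `V → T₁ Q` is then extended by transposing it, extending over `Λ ⊗ W` by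
injectivity of `Q`, and transposing back.

The general part (`exists_grothendieck_spectralSequence`) applies the functor to an injective
resolution and regards the resulting complex `X` as an object of the derived category. The groups
`Hom(B, τ_{[i,j)} X[n])` form a first quadrant spectral object. On its second page `τ_{[q,q+1)} X`
is the single homology object `R^q G M`, which gives Ext groups. Its abutment `Hom(B, X[n])` is
computed by the complex `Hom(B, X)`, because the terms of `X` are injective, and the first fact
turns this complex into the one that computes `Extⁿ(A, M)`. -/

/-- If `B → E` is onto with kernel `im i + ker a`, then `E` is `im a / im (a ∘ i)`. -/
theorem nonempty_rangeQuotientEquiv {R A B C E : Type*} [Ring R] [AddCommGroup A] [AddCommGroup B]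
    [AddCommGroup C] [AddCommGroup E] [Module R A] [Module R B] [Module R C] [Module R E]
    (i : A →ₗ[R] B) (a : B →ₗ[R] C) (π : B →ₗ[R] E) (hπ : Function.Surjective π)
    (hker : LinearMap.ker π = LinearMap.range i ⊔ LinearMap.ker a) :
    Nonempty ((LinearMap.range a ⧸
      (LinearMap.range (a ∘ₗ i)).submoduleOf (LinearMap.range a)) ≃ₗ[R] E) := by
  let g : B →ₗ[R] (LinearMap.range a ⧸
      (LinearMap.range (a ∘ₗ i)).submoduleOf (LinearMap.range a)) :=
    Submodule.mkQ _ ∘ₗ a.rangeRestrict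
  have hg : Function.Surjective g :=
    (Submodule.mkQ_surjective _).comp a.surjective_rangeRestrict
  have hkg : LinearMap.ker g = LinearMap.ker π := by
    rw [hker]
    ext b
    have h1 : b ∈ LinearMap.ker g ↔ a b ∈ LinearMap.range (a ∘ₗ i) := by
      rw [LinearMap.mem_ker, LinearMap.comp_apply, Submodule.mkQ_apply,
        Submodule.Quotient.mk_eq_zero]
      rfl
    rw [h1, Submodule.mem_sup]
    constructor
    · rintro ⟨x, hx⟩
      exact ⟨i x, ⟨x, rfl⟩, b - i x, by simpa [sub_eq_zero] using hx.symm, by simp⟩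
    · rintro ⟨_, ⟨x, rfl⟩, z, hz, rfl⟩
      exact ⟨x, by simpa using hz⟩
  exact ⟨(g.quotKerEquivOfSurjective hg).symm ≪≫ₗ Submodule.quotEquivOfEq _ _ hkg ≪≫ₗ
    π.quotKerEquivOfSurjective hπ⟩

/-- The range of a morphism out of a biproduct. -/
theorem ModuleCat.range_biprod_desc {R : Type*} [Ring R] {M N P : ModuleCat.{u} R}
    (f : M ⟶ P) (g : N ⟶ P) :
    LinearMap.range (Limits.biprod.desc f g).hom =
      LinearMap.range f.hom ⊔ LinearMap.range g.hom := by
  apply le_antisymm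
  · rintro _ ⟨x, rfl⟩
    have h : Limits.biprod.desc f g =
        Limits.biprod.fst ≫ f + Limits.biprod.snd ≫ g := by
      apply Limits.biprod.hom_ext' <;> simp
    rw [h]
    exact Submodule.add_mem_sup ⟨_, rfl⟩ ⟨_, rfl⟩
  · refine sup_le ?_ ?_
    · conv_lhs => rw [← Limits.biprod.inl_desc f g]
      rintro _ ⟨x, rfl⟩
      exact ⟨_, rfl⟩
    · conv_lhs => rw [← Limits.biprod.inr_desc f g]
      rintro _ ⟨x, rfl⟩
      exact ⟨_, rfl⟩

/-! ### Convergence of first quadrant spectral objects -/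

namespace CategoryTheory.Abelian.SpectralObject

open ComposableArrows

variable {K : Type u} [Field K] (Y : SpectralObject (ModuleCat.{u} K) EInt)

/-- For indices `⊥ ≤ i ≤ j ≤ ⊤`, the term `Eⁿ(⊥, i, j, ⊤)` is the quotient of the images of
`Hⁿ(⊥ ≤ j)` and `Hⁿ(⊥ ≤ i)` in `Hⁿ(⊥ ≤ ⊤)`. -/
theorem nonempty_rangeQuotientEquiv_E (i j : EInt) (hij : i ≤ j) (n₀ n₁ n₂ : ℤ)
    (hn₁ : n₀ + 1 = n₁) (hn₂ : n₁ + 1 = n₂) :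
    Nonempty ((LinearMap.range ((Y.H n₁).map (twoδ₂Toδ₁' ⊥ j ⊤ bot_le le_top)).hom ⧸
      (LinearMap.range ((Y.H n₁).map (twoδ₂Toδ₁' ⊥ i ⊤ bot_le le_top)).hom).submoduleOf
        (LinearMap.range ((Y.H n₁).map (twoδ₂Toδ₁' ⊥ j ⊤ bot_le le_top)).hom)) ≃ₗ[K]
      Y.E (homOfLE (bot_le : ⊥ ≤ i)) (homOfLE hij) (homOfLE (le_top : j ≤ ⊤))
        n₀ n₁ n₂ hn₁ hn₂) := by
  have hcomp : ((Y.H n₁).map (twoδ₂Toδ₁' ⊥ i ⊤ bot_le le_top)).hom =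
      ((Y.H n₁).map (twoδ₂Toδ₁' ⊥ j ⊤ bot_le le_top)).hom ∘ₗ
        ((Y.H n₁).map (twoδ₂Toδ₁' ⊥ i j bot_le hij)).hom := by
    rw [← ModuleCat.hom_comp, ← Functor.map_comp]
    rfl
  rw [hcomp]
  -- `E` is the quotient of `Hⁿ(⊥ ≤ j)` by the image of `Hⁿ(⊥ ≤ i)` and the image of the connecting
  -- map from `j ≤ ⊤`; by `hδ` the latter is the kernel of the map to the abutment.
  have hex := Y.cokernelSequenceE_exact (homOfLE (bot_le : ⊥ ≤ i)) (homOfLE hij)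
    (homOfLE (le_top : j ≤ ⊤)) (homOfLE bot_le) rfl n₀ n₁ n₂ hn₁ hn₂
  have hepi : Epi (Y.cokernelSequenceE (homOfLE (bot_le : ⊥ ≤ i)) (homOfLE hij)
    (homOfLE (le_top : j ≤ ⊤)) (homOfLE bot_le) rfl n₀ n₁ n₂ hn₁ hn₂).g := inferInstance
  have hδ := Y.exact₁ (homOfLE (bot_le : ⊥ ≤ j)) (homOfLE (le_top : j ≤ ⊤)) (homOfLE bot_le)
    rfl n₀ n₁ hn₁
  rw [ShortComplex.moduleCat_exact_iff_range_eq_ker] at hex hδ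
  refine nonempty_rangeQuotientEquiv _ _
    (Y.toCycles (homOfLE (bot_le : ⊥ ≤ i)) (homOfLE hij) (homOfLE bot_le) rfl n₁ ≫
      Y.πE _ _ (homOfLE (le_top : j ≤ ⊤)) n₀ n₁ n₂ hn₁ hn₂).hom
    ((ModuleCat.epi_iff_surjective _).1 hepi) ?_
  refine hex.symm.trans ?_
  exact (ModuleCat.range_biprod_desc _ _).trans (congrArg₂ (· ⊔ ·) rfl hδ)

/-- The image of `Hⁿ(⊥ ≤ i)` in the abutment `Hⁿ(⊥ ≤ ⊤)`. -/
noncomputable def abutmentRange (n : ℤ) (i : EInt) :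
    Submodule K ((Y.H n).obj (mk₁ (homOfLE (bot_le : (⊥ : EInt) ≤ ⊤)))) :=
  LinearMap.range ((Y.H n).map (twoδ₂Toδ₁' ⊥ i ⊤ bot_le le_top)).hom

theorem abutmentRange_mono (n : ℤ) : Monotone (Y.abutmentRange n) := by
  intro i j hij
  have hcomp : (Y.H n).map (twoδ₂Toδ₁' ⊥ i ⊤ bot_le le_top) =
      (Y.H n).map (twoδ₂Toδ₁' ⊥ i j bot_le hij) ≫
        (Y.H n).map (twoδ₂Toδ₁' ⊥ j ⊤ bot_le le_top) := by
    rw [← Functor.map_comp]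
    rfl
  rw [abutmentRange, abutmentRange, hcomp]
  rintro _ ⟨x, rfl⟩
  exact ⟨_, rfl⟩

/-- The spectral sequence of a first quadrant spectral object `Y` converges to `Hⁿ(⊥ ≤ ⊤)`. -/
theorem convergesTo [Y.IsFirstQuadrant] :
    ConvergesTo Y.E₂SpectralSequenceNat
      (fun n => (Y.H n).obj (mk₁ (homOfLE (bot_le : (⊥ : EInt) ≤ ⊤)))) := by
  intro n
  -- With `q = n - p`, the piece `E^{p,q}` belongs to the interval from `q` to `q + 1`, so `F^p` is
  -- the image of `Hⁿ(⊥ ≤ q + 1)`. At `p = 0` the index is `n + 1`, beyond which `Hⁿ` vanishes; at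
  -- `p = n + 1` it is `0`, below which everything vanishes.
  refine ⟨fun p => Y.abutmentRange n (((n : ℤ) - p + 1 : ℤ) : EInt), ?_, ?_, ?_, ?_⟩
  · intro p p' h
    exact Y.abutmentRange_mono n (WithBotTop.coe_le_coe.2 (by omega))
  · have hz := Y.isZero₂_of_isFirstQuadrant (((n : ℤ) - (0 : ℕ) + 1 : ℤ) : EInt) ⊤ le_top n
      (WithBotTop.coe_lt_coe.2 (by omega))
    have hepi := (Y.exact₂ (homOfLE (bot_le : ⊥ ≤ (((n : ℤ) - (0 : ℕ) + 1 : ℤ) : EInt)))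
      (homOfLE le_top) (homOfLE bot_le) rfl n).epi_f (hz.eq_of_tgt _ _)
    exact LinearMap.range_eq_top.2 ((ModuleCat.epi_iff_surjective _).1 hepi)
  · have hz := Y.isZero₁_of_isFirstQuadrant ⊥ (((n : ℤ) - (n + 1 : ℕ) + 1 : ℤ) : EInt) bot_le
      (WithBotTop.coe_le_coe.2 (by omega)) n
    change LinearMap.range _ = ⊥
    rw [hz.eq_of_src ((Y.H n).map (twoδ₂Toδ₁' ⊥ (((n : ℤ) - (n + 1 : ℕ) + 1 : ℤ) : EInt) ⊤
      bot_le le_top)) 0]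
    exact LinearMap.range_zero
  · rintro p q rfl
    -- On page `r = p + q + 2` the outer indices are `q - r + 2 = -p ≤ 0` and `q + r - 1 = p + 2q +
    -- 1 > p + q`. The first quadrant vanishing then allows them to be replaced by `⊥` and `⊤`
    -- (`e2`, `e3`).
    have hr : (2 : ℤ) ≤ (p : ℤ) + q + 2 := by omega
    have e1 := Y.spectralSequencePageXIso coreE₂CohomologicalNat ((p : ℤ) + q + 2) hr (p, q)
      ((q - (p + q + 2) + 2 : ℤ) : EInt) ((q : ℤ) : EInt) ((q + 1 : ℤ) : EInt)
      ((q + (p + q + 2) - 1 : ℤ) : EInt) rfl rfl rfl rfl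
      (((p + q : ℕ) : ℤ) - 1) ((p + q : ℕ) : ℤ) (((p + q : ℕ) : ℤ) + 1)
      (Nat.cast_add p q)
    have e2 := Y.isoMapFourδ₁Toδ₀' ⊥ ((q - (p + q + 2) + 2 : ℤ) : EInt) ((q : ℤ) : EInt)
      ((q + 1 : ℤ) : EInt) ((q + (p + q + 2) - 1 : ℤ) : EInt) bot_le
      (WithBotTop.coe_le_coe.2 (by omega)) (WithBotTop.coe_le_coe.2 (by omega))
      (WithBotTop.coe_le_coe.2 (by omega))
      (((p + q : ℕ) : ℤ) - 1) ((p + q : ℕ) : ℤ) (((p + q : ℕ) : ℤ) + 1)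
      (Y.isZero₁_of_isFirstQuadrant _ _ _ (WithBotTop.coe_le_coe.2 (by omega)) _)
    have e3 := Y.isoMapFourδ₄Toδ₃' ⊥ ((q : ℤ) : EInt)
      ((q + 1 : ℤ) : EInt) ((q + (p + q + 2) - 1 : ℤ) : EInt) ⊤ bot_le
      (WithBotTop.coe_le_coe.2 (by omega)) (WithBotTop.coe_le_coe.2 (by omega)) le_top
      (((p + q : ℕ) : ℤ) - 1) ((p + q : ℕ) : ℤ) (((p + q : ℕ) : ℤ) + 1)
      (Y.isZero₂_of_isFirstQuadrant _ _ _ _ (WithBotTop.coe_lt_coe.2 (by omega)))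
    obtain ⟨e⟩ := Y.nonempty_rangeQuotientEquiv_E ((q : ℤ) : EInt)
      ((q + 1 : ℤ) : EInt) (WithBotTop.coe_le_coe.2 (by omega))
      (((p + q : ℕ) : ℤ) - 1) ((p + q : ℕ) : ℤ) (((p + q : ℕ) : ℤ) + 1) (by omega) rfl
    -- The indices of the filtration equal `q` and `q + 1` only after arithmetic, so they are
    -- generalized before substitution.
    have key : ∀ i j : ℤ, i = q → j = q + 1 →
        Nonempty ((Y.abutmentRange ((p + q : ℕ) : ℤ) (j : EInt) ⧸
          (Y.abutmentRange ((p + q : ℕ) : ℤ) (i : EInt)).submoduleOf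
            (Y.abutmentRange ((p + q : ℕ) : ℤ) (j : EInt))) ≃ₗ[K]
          pageInfinity Y.E₂SpectralSequenceNat p q) := by
      rintro _ _ rfl rfl
      exact ⟨e ≪≫ₗ (e1 ≪≫ e2.symm ≪≫ e3).symm.toLinearEquiv⟩
    exact key _ _ (by push_cast; ring) (by push_cast; ring)

end CategoryTheory.Abelian.SpectralObject

/-! ### Linear Hom functors on triangulated spectral objects -/

namespace CategoryTheory

open Pretriangulated ComposableArrows Opposite

section

variable {K : Type*} [CommRing K] {T : Type*} [Category T] [Preadditive T] [Linear K T] (A : T)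
  [∀ B : T, Small.{u} (A ⟶ B)]

variable (K) in
/-- The functor `Hom(A, -)` with values in `u`-small `K`-modules. -/
noncomputable def linearCoyonedaShrink : T ⥤ ModuleCat.{u} K where
  obj B := ModuleCat.of K (Shrink.{u} (A ⟶ B))
  map {B C} f := ModuleCat.ofHom ((Shrink.linearEquiv K (A ⟶ C)).symm.toLinearMap ∘ₗ
    Linear.rightComp K A f ∘ₗ (Shrink.linearEquiv K (A ⟶ B)).toLinearMap)
  map_id B := by ext x; simp
  map_comp f g := by ext x; simp

variable (K) in
/-- The canonical linear equivalence `Hom(A, B) ≃ (linearCoyonedaShrink K A).obj B`. -/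
noncomputable def linearCoyonedaShrinkEquiv (B : T) :
    (A ⟶ B) ≃ₗ[K] (linearCoyonedaShrink.{u} K A).obj B :=
  (Shrink.linearEquiv K (A ⟶ B)).symm

theorem linearCoyonedaShrink_map_apply {B C : T} (f : B ⟶ C) (x : A ⟶ B) :
    ((linearCoyonedaShrink.{u} K A).map f).hom (linearCoyonedaShrinkEquiv K A B x) =
      linearCoyonedaShrinkEquiv K A C (x ≫ f) := by
  change (Shrink.linearEquiv K (A ⟶ C)).symm
    ((Shrink.linearEquiv K (A ⟶ B)) ((Shrink.linearEquiv K (A ⟶ B)).symm x) ≫ f) = _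
  rw [LinearEquiv.apply_symm_apply]
  rfl

/-- Exactness is reduced to a lifting property of morphisms, where neither linearity nor the choice
of a small model of the Hom sets intervenes. The long exact sequences of abelian groups attached to
`Hom(A, -)` can then be quoted directly. -/
theorem linearCoyonedaShrink_exact {B C D : T} (f : B ⟶ C) (g : C ⟶ D) (w : f ≫ g = 0)
    (h : ∀ x : A ⟶ C, x ≫ g = 0 → ∃ y : A ⟶ B, y ≫ f = x) :
    (mk₂ ((linearCoyonedaShrink.{u} K A).map f) ((linearCoyonedaShrink.{u} K A).map g)).Exact := by
  have w' : (linearCoyonedaShrink.{u} K A).map f ≫ (linearCoyonedaShrink.{u} K A).map g = 0 := by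
    rw [← Functor.map_comp, w]
    ext x
    obtain ⟨x, rfl⟩ := (linearCoyonedaShrinkEquiv K A _).surjective x
    rw [linearCoyonedaShrink_map_apply, Limits.comp_zero, map_zero]
    rfl
  refine (ShortComplex.Exact.exact_toComposableArrows (S := ShortComplex.mk _ _ w') ?_)
  rw [ShortComplex.moduleCat_exact_iff]
  intro x hx
  obtain ⟨x, rfl⟩ := (linearCoyonedaShrinkEquiv K A _).surjective x
  obtain ⟨y, hy⟩ := h x ((linearCoyonedaShrinkEquiv K A _).map_eq_zero_iff.1
    ((linearCoyonedaShrink_map_apply A g x).symm.trans hx))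
  exact ⟨linearCoyonedaShrinkEquiv K A _ y,
    (linearCoyonedaShrink_map_apply A f y).trans (by rw [hy])⟩

variable [Limits.HasZeroObject T] [HasShift T ℤ] [∀ n : ℤ, (shiftFunctor T n).Additive]
  [Pretriangulated T] (X : Triangle T) (hX : X ∈ distTriang T)

include hX in
variable (K) in
theorem linearCoyonedaShrink_exact₁ (n₀ n₁ : ℤ) (h : n₀ + 1 = n₁) :
    (mk₂ ((linearCoyonedaShrink.{u} K A).map
        (X.mor₃⟦n₀⟧' ≫ (shiftFunctorAdd' T 1 n₀ n₁ (by lia)).inv.app X.obj₁))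
      ((linearCoyonedaShrink.{u} K A).map (X.mor₁⟦n₁⟧'))).Exact := by
  apply linearCoyonedaShrink_exact
  · have hn := (shiftFunctorAdd' T 1 n₀ n₁ (by lia)).inv.naturality X.mor₁
    dsimp at hn
    rw [Category.assoc, ← hn, ← Functor.map_comp_assoc, comp_distTriang_mor_zero₃₁ _ hX,
      Functor.map_zero, Limits.zero_comp]
  · intro x hx
    have := (preadditiveCoyoneda.obj (op A)).homologySequence_exact₁ _ hX n₀ n₁ h
    rw [ShortComplex.ab_exact_iff] at this
    obtain ⟨y, hy⟩ := this x hx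
    exact ⟨y, (preadditiveCoyoneda_homologySequenceδ_apply X n₀ n₁ h y).symm.trans hy⟩

include hX in
variable (K) in
theorem linearCoyonedaShrink_exact₂ (n : ℤ) :
    (mk₂ ((linearCoyonedaShrink.{u} K A).map (X.mor₁⟦n⟧'))
      ((linearCoyonedaShrink.{u} K A).map (X.mor₂⟦n⟧'))).Exact := by
  apply linearCoyonedaShrink_exact
  · rw [← Functor.map_comp, comp_distTriang_mor_zero₁₂ _ hX, Functor.map_zero]
  · intro x hx
    have := (preadditiveCoyoneda.obj (op A)).homologySequence_exact₂ _ hX n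
    rw [ShortComplex.ab_exact_iff] at this
    exact this x hx

include hX in
variable (K) in
theorem linearCoyonedaShrink_exact₃ (n₀ n₁ : ℤ) (h : n₀ + 1 = n₁) :
    (mk₂ ((linearCoyonedaShrink.{u} K A).map (X.mor₂⟦n₀⟧'))
      ((linearCoyonedaShrink.{u} K A).map
        (X.mor₃⟦n₀⟧' ≫ (shiftFunctorAdd' T 1 n₀ n₁ (by lia)).inv.app X.obj₁))).Exact := by
  apply linearCoyonedaShrink_exact
  · rw [← Functor.map_comp_assoc, comp_distTriang_mor_zero₂₃ _ hX, Functor.map_zero,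
      Limits.zero_comp]
  · intro x hx
    have := (preadditiveCoyoneda.obj (op A)).homologySequence_exact₃ _ hX n₀ n₁ h
    rw [ShortComplex.ab_exact_iff] at this
    exact this x ((preadditiveCoyoneda_homologySequenceδ_apply X n₀ n₁ h x).trans hx)

end

section

variable (K : Type*) [CommRing K] {T : Type*} [Category T] [Preadditive T] [Linear K T]
  [Limits.HasZeroObject T] [HasShift T ℤ] [∀ n : ℤ, (shiftFunctor T n).Additive]
  [Pretriangulated T] (A : T) [∀ B : T, Small.{u} (A ⟶ B)]
  {ι : Type*} [Category ι] (X : Triangulated.SpectralObject T ι)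

/-- Applying `Hom(A, -)` to a spectral object in a triangulated category gives a spectral
object in the category of modules. -/
noncomputable def Triangulated.SpectralObject.linearCoyoneda :
    Abelian.SpectralObject (ModuleCat.{u} K) ι where
  H n := X.ω₁ ⋙ shiftFunctor T n ⋙ linearCoyonedaShrink.{u} K A
  δ' n₀ n₁ h :=
    { app D := (linearCoyonedaShrink.{u} K A).map ((X.δ'.app D)⟦n₀⟧' ≫
        (shiftFunctorAdd' T 1 n₀ n₁ (by lia)).inv.app _)
      naturality D D' f := by
        have h1 := X.δ'.naturality f
        have h2 := (shiftFunctorAdd' T 1 n₀ n₁ (by lia)).inv.naturality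
          ((functorArrows ι 0 1 2 ⋙ X.ω₁).map f)
        dsimp at h1 h2 ⊢
        rw [← Functor.map_comp, ← Functor.map_comp, ← Functor.map_comp_assoc, h1,
          Functor.map_comp_assoc, Category.assoc, h2] }
  exact₁' n₀ n₁ h D := linearCoyonedaShrink_exact₁ K A _ (X.distinguished' D) n₀ n₁ h
  exact₂' n D := linearCoyonedaShrink_exact₂ K A _ (X.distinguished' D) n
  exact₃' n₀ n₁ h D := linearCoyonedaShrink_exact₃ K A _ (X.distinguished' D) n₀ n₁ h

end

end CategoryTheory

theorem Int.two_le_two : (2 : ℤ) ≤ 2 := le_rfl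

/-! ### Truncations and the second page -/

namespace DerivedCategory

open Limits Pretriangulated TStructure

universe w v u'

variable {C : Type u'} [Category.{v} C] [Abelian C] [HasDerivedCategory.{w} C]

/-- In the long exact homology sequence the map in degree `q` stands between the homology of the
third vertex in degrees `q - 1` and `q`, and both vanish. -/
theorem isIso_homologyFunctor_map_mor₁ (T : Triangle (DerivedCategory C)) (hT : T ∈ distTriang _)
    (q₀ q : ℤ) (hq : q₀ + 1 = q) (h₀ : IsZero ((homologyFunctor C q₀).obj T.obj₃))
    (h₁ : IsZero ((homologyFunctor C q).obj T.obj₃)) :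
    IsIso ((homologyFunctor C q).map T.mor₁) := by
  have h1 := (homologyFunctor C 0).homologySequence_exact₁ T hT q₀ q hq
  have h2 := (homologyFunctor C 0).homologySequence_exact₂ T hT q
  have : Mono ((homologyFunctor C q).map T.mor₁) := h1.mono_g (h₀.eq_of_src _ _)
  have : Epi ((homologyFunctor C q).map T.mor₁) := h2.epi_f (h₁.eq_of_tgt _ _)
  exact isIso_of_mono_of_epi _

theorem isIso_homologyFunctor_map_mor₂ (T : Triangle (DerivedCategory C)) (hT : T ∈ distTriang _)
    (q q₁ : ℤ) (hq : q + 1 = q₁) (h₀ : IsZero ((homologyFunctor C q).obj T.obj₁))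
    (h₁ : IsZero ((homologyFunctor C q₁).obj T.obj₁)) :
    IsIso ((homologyFunctor C q).map T.mor₂) := by
  have h2 := (homologyFunctor C 0).homologySequence_exact₂ T hT q
  have h3 := (homologyFunctor C 0).homologySequence_exact₃ T hT q q₁ hq
  have : Mono ((homologyFunctor C q).map T.mor₂) := h2.mono_g (h₀.eq_of_src _ _)
  have : Epi ((homologyFunctor C q).map T.mor₂) := h3.epi_f (h₁.eq_of_tgt _ _)
  exact isIso_of_mono_of_epi _

/-- The homology in degree `q` of the truncation of `X` to degree `q` is that of `X`. -/
theorem nonempty_homology_truncGE_truncLT_iso (X : DerivedCategory C) (q : ℤ) :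
    Nonempty ((homologyFunctor C q).obj ((t.truncGE q).obj ((t.truncLT (q + 1)).obj X)) ≅
      (homologyFunctor C q).obj X) := by
  have i1 := isIso_homologyFunctor_map_mor₁ _ (t.triangleLTGE_distinguished (q + 1) X)
    (q - 1) q (by lia) (isZero_of_isGE _ (q + 1) _ (by lia) (hX := inferInstanceAs
      (t.IsGE ((t.truncGE (q + 1)).obj X) (q + 1))))
      (isZero_of_isGE _ (q + 1) _ (by lia) (hX := inferInstanceAs
      (t.IsGE ((t.truncGE (q + 1)).obj X) (q + 1))))
  have i2 := isIso_homologyFunctor_map_mor₂ _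
    (t.triangleLTGE_distinguished q ((t.truncLT (q + 1)).obj X)) q (q + 1) rfl
    (isZero_of_isLE _ (q - 1) _ (by lia) (hX := inferInstanceAs
      (t.IsLE ((t.truncLT q).obj ((t.truncLT (q + 1)).obj X)) (q - 1))))
    (isZero_of_isLE _ (q - 1) _ (by lia) (hX := inferInstanceAs
      (t.IsLE ((t.truncLT q).obj ((t.truncLT (q + 1)).obj X)) (q - 1))))
  exact ⟨(@asIso _ _ _ _ _ i2).symm ≪≫ @asIso _ _ _ _ _ i1⟩

/-- The truncation of `X` to degree `q` is the homology of `X` placed in degree `q`. -/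
theorem nonempty_truncGE_truncLT_iso_single (X : DerivedCategory C) (q : ℤ) :
    Nonempty ((t.truncGE q).obj ((t.truncLT (q + 1)).obj X) ≅
      (singleFunctor C q).obj ((homologyFunctor C q).obj X)) := by
  have : t.IsLE ((t.truncLT (q + 1)).obj X) q := inferInstance
  have : IsLE ((t.truncGE q).obj ((t.truncLT (q + 1)).obj X)) q := inferInstance
  have : IsGE ((t.truncGE q).obj ((t.truncLT (q + 1)).obj X)) q :=
    inferInstanceAs (t.IsGE _ _)
  obtain ⟨V, ⟨e⟩⟩ := exists_iso_singleFunctor_obj_of_isGE_of_isLE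
    ((t.truncGE q).obj ((t.truncLT (q + 1)).obj X)) q
  obtain ⟨e'⟩ := nonempty_homology_truncGE_truncLT_iso X q
  exact ⟨e ≪≫ (singleFunctor C q).mapIso
    ((((HomologicalComplex.homologyFunctorSingleIso C _ q).symm.app V) ≪≫
      (homologyFunctorFactors C q).symm.app _ ≪≫
      (homologyFunctor C q).mapIso ((singleFunctorIsoCompQ C q).symm.app V)) ≪≫
    (homologyFunctor C q).mapIso e.symm ≪≫ e')⟩

/-- Morphisms out of an object of the heart are `v`-small, as this object has a projective
resolution. -/
theorem small_hom_singleFunctor [EnoughProjectives C] (A : C) (B : DerivedCategory C) :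
    Small.{v} ((singleFunctor C 0).obj A ⟶ B) := by
  let R := ProjectiveResolution.of A
  let L := Q.objPreimage B
  let e : Q.obj L ≅ B := Q.objObjPreimageIso B
  have hs : Function.Surjective (Q.map : (R.cochainComplex ⟶ L) → _) := by
    intro f
    obtain ⟨g, hg⟩ := (CochainComplex.IsKProjective.Qh_map_bijective R.cochainComplex
      ((HomotopyCategory.quotient _ _).obj L)).surjective
      ((quotientCompQhIso C).hom.app _ ≫ f ≫ (quotientCompQhIso C).inv.app _)
    obtain ⟨g, rfl⟩ := (HomotopyCategory.quotient _ _).map_surjective g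
    refine ⟨g, ?_⟩
    rw [← NatIso.naturality_1 (quotientCompQhIso C) g]
    dsimp at hg ⊢
    rw [hg]
    simp
  let e' : Q.obj R.cochainComplex ≅ (singleFunctor C 0).obj A :=
    asIso (Q.map R.π') ≪≫ ((singleFunctorIsoCompQ C 0).app A).symm
  have : Small.{v} (Q.obj R.cochainComplex ⟶ Q.obj L) := small_of_surjective hs
  exact small_map (Iso.homCongr e' e).symm

section SpectralObject

variable (K : Type*) [CommRing K] [Linear K C] [EnoughProjectives C] (A : C)
  (X : DerivedCategory C)

attribute [local instance] small_hom_singleFunctor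

/-- The spectral object with terms `Hom(A, τ_{[i, j)} X[n])` in the derived category. -/
noncomputable def homSpectralObject : Abelian.SpectralObject (ModuleCat.{v} K) EInt :=
  (t.spectralObject X).linearCoyoneda K ((singleFunctor C 0).obj A)

/-- The abutment `Hⁿ(⊥ ≤ ⊤)` of `homSpectralObject` is `Hom(A, X[n])`. -/
noncomputable def homSpectralObjectAbutmentEquiv (n : ℤ) :
    ((singleFunctor C 0).obj A ⟶ X⟦n⟧) ≃ₗ[K] ((homSpectralObject K A X).H n).obj
      (ComposableArrows.mk₁ (homOfLE (bot_le : (⊥ : EInt) ≤ ⊤))) :=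
  linearCoyonedaShrinkEquiv K ((singleFunctor C 0).obj A) (X⟦n⟧)

theorem isZero_linearCoyonedaShrink_obj {T : Type*} [Category T] [Preadditive T] [Linear K T]
    (A B : T) [∀ B : T, Small.{v} (A ⟶ B)] (h : ∀ f : A ⟶ B, f = 0) :
    IsZero ((linearCoyonedaShrink.{v} K A).obj B) := by
  have : Subsingleton ((linearCoyonedaShrink.{v} K A).obj B) :=
    (linearCoyonedaShrinkEquiv K A B).symm.toEquiv.subsingleton_congr.2
      (subsingleton_of_forall_eq 0 h)
  exact ModuleCat.isZero_of_subsingleton _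

/-- For `j ≤ 0` the truncation of `X` below `j` is zero. For `i > n` the truncated object lies in
degrees at least `n + 1`, so its shift by `n` lies in degrees at least `1` and receives no nonzero
map from an object in degree `0`. -/
instance [X.IsGE 0] : (homSpectralObject K A X).IsFirstQuadrant where
  isZero₁ i j hij hj n := by
    apply isZero_linearCoyonedaShrink_obj
    intro f
    have hz := t.isZero_eTruncLT_obj_obj X 0 j hj
    exact ((shiftFunctor _ n).map_isZero ((t.eTruncGE.obj i).map_isZero hz)).eq_of_tgt _ _
  isZero₂ i j hij n hi := by
    apply isZero_linearCoyonedaShrink_obj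
    intro f
    have h1 := t.isGE_eTruncGE_obj_obj (n + 1) i (by
      induction i using WithBotTop.rec with
      | bot => simp at hi
      | coe i =>
        simp only [WithBotTop.coe_lt_coe, WithBotTop.coe_le_coe] at hi ⊢
        exact hi
      | top => simp) ((t.eTruncLT.obj j).obj X)
    have h2 := t.isGE_shift ((t.eTruncGE.obj i).obj ((t.eTruncLT.obj j).obj X)) (n + 1) n 1
    exact t.zero_of_isLE_of_isGE f 0 1 (by lia)
      (inferInstanceAs (IsLE ((singleFunctor C 0).obj A) 0)) h2

/-- The second page of the spectral sequence attached to `homSpectralObject`. -/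
theorem nonempty_homSpectralObject_page_two [X.IsGE 0] [HasExt.{v} C] (p q : ℕ) :
    Nonempty (((homSpectralObject K A X).E₂SpectralSequenceNat.page 2 Int.two_le_two).X (p, q) ≅
      ModuleCat.of K (Abelian.Ext A ((homologyFunctor C (q : ℤ)).obj X) p)) := by
  have e1 := (homSpectralObject K A X).spectralSequenceFirstPageXIso
    Abelian.SpectralObject.coreE₂CohomologicalNat (p, q) ((q : ℤ) : EInt)
    ((q + 1 : ℤ) : EInt) rfl rfl ((p : ℤ) + q) rfl
  obtain ⟨e2⟩ := nonempty_truncGE_truncLT_iso_single X q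
  let V := (homologyFunctor C (q : ℤ)).obj X
  -- The shift by `p + q` is split: `q` of it moves the homology object from degree `q` to degree
  -- `0`, and `p` remains as the Ext degree.
  let e3 : ((t.truncGE q).obj ((t.truncLT (q + 1)).obj X))⟦(p : ℤ) + q⟧ ≅
      ((singleFunctor C 0).obj V)⟦(p : ℤ)⟧ :=
    (shiftFunctor _ ((p : ℤ) + q)).mapIso e2 ≪≫
      ((shiftFunctorAdd' (DerivedCategory C) (q : ℤ) (p : ℤ) ((p : ℤ) + q) (add_comm _ _)).app _) ≪≫
      (shiftFunctor _ (p : ℤ)).mapIso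
        (((singleFunctors C).shiftIso (q : ℤ) 0 (q : ℤ) (add_zero _)).app V)
  exact ⟨e1 ≪≫ (linearCoyonedaShrink K ((singleFunctor C 0).obj A)).mapIso e3 ≪≫
    ((linearCoyonedaShrinkEquiv K ((singleFunctor C 0).obj A) _).symm ≪≫ₗ
      (Abelian.Ext.homLinearEquiv (R := K) (X := A) (Y := V) (n := p)).symm).toModuleIso⟩

end SpectralObject

end DerivedCategory

/-! ### Derived morphisms into complexes of injectives -/

namespace CochainComplex.HomComplex.Cocycle

open CategoryTheory

theorem equivHomShift_symm_smul {C : Type*} [Category* C] [Preadditive C] {K : Type*} [CommRing K]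
    [Linear K C] {L M : CochainComplex C ℤ} {n : ℤ} (r : K) (z : Cocycle L M n) :
    equivHomShift.symm (r • z) = r • equivHomShift.symm z := by
  obtain ⟨f, rfl⟩ := equivHomShift.surjective z
  rw [AddEquiv.symm_apply_apply]
  apply equivHomShift.injective
  rw [AddEquiv.apply_symm_apply]
  ext p q hpq
  subst hpq
  simp [equivHomShift_apply, Cochain.rightUnshift_v _ _ _ _ _ _ _ (add_zero p)]
  exact congrArg (r • ·) (Category.comp_id _)

end CochainComplex.HomComplex.Cocycle

namespace DerivedCategory

open Limits CochainComplex HomComplex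

universe w w' v u'

variable {C : Type u'} [Category.{v} C] [Abelian C] [HasDerivedCategory.{w} C]
  (K : Type*) [CommRing K] [Linear K C]

section

variable (A : C) (L : CochainComplex C ℤ) (n : ℤ)

/-- The cocycle given by a morphism `f : A ⟶ L.X n` such that `f ≫ L.d n (n + 1) = 0`. -/
noncomputable def cocycleOfSingle :
    LinearMap.ker (Linear.rightComp K A (L.d n (n + 1))) →ₗ[K]
      Cocycle ((CochainComplex.singleFunctor C 0).obj A) L n where
  toFun f := Cocycle.fromSingleMk f.1 (zero_add n) (n + 1) rfl (show f.1 ≫ _ = 0 from f.2)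
  map_add' f g := Subtype.ext (Cochain.fromSingleMk_add f.1 g.1 (zero_add n))
  map_smul' r f := Subtype.ext (by
    apply (Cochain.fromSingleEquiv (zero_add n)).injective
    change Cochain.fromSingleEquiv (zero_add n) (Cochain.fromSingleMk (r • f.1) (zero_add n)) =
      Cochain.fromSingleEquiv (zero_add n) (r • Cochain.fromSingleMk f.1 (zero_add n))
    simp only [Cochain.fromSingleEquiv_fromSingleMk]
    simp only [Cochain.fromSingleEquiv, AddEquiv.coe_mk, Equiv.coe_fn_mk, Cochain.smul_v,
      Cochain.fromSingleMk_v]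
    exact ((Linear.comp_smul _ _ _ _ _ _).trans (congrArg _ (Iso.inv_hom_id_assoc _ _))).symm)

/-- The morphism `A ⟶ L[n]` in the derived category given by a cocycle `f : A ⟶ L.X n`. -/
noncomputable def homSingleOfCocycle :
    LinearMap.ker (Linear.rightComp K A (L.d n (n + 1))) →ₗ[K]
      ((singleFunctor C 0).obj A ⟶ (Q.obj L)⟦n⟧) where
  toFun f := (singleFunctorIsoCompQ C 0).hom.app A ≫
    Q.map (Cocycle.equivHomShift.symm (cocycleOfSingle K A L n f)) ≫
      (Q.commShiftIso n).hom.app L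
  map_add' f g := by
    rw [← Preadditive.comp_add, ← Preadditive.add_comp, ← Functor.map_add, ← map_add,
      ← map_add]
  map_smul' r f := by
    rw [RingHom.id_apply, ← Linear.comp_smul, ← Linear.smul_comp, ← Functor.map_smul,
      ← Cocycle.equivHomShift_symm_smul, ← map_smul]

/-- The object `A` of the derived category as the image of an object of the homotopy category. -/
noncomputable def singleFunctorIsoQh : (singleFunctor C 0).obj A ≅
    Qh.obj ((HomotopyCategory.quotient _ _).obj ((CochainComplex.singleFunctor C 0).obj A)) :=
  (singleFunctorIsoCompQ C 0).app A ≪≫ (quotientCompQhIso C).symm.app _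

/-- The localization functor from the homotopy category commutes with shifts on complexes. -/
noncomputable def qhShiftIso :
    Qh.obj ((HomotopyCategory.quotient _ _).obj (L⟦n⟧)) ≅ (Q.obj L)⟦n⟧ :=
  (quotientCompQhIso C).app _ ≪≫ (Q.commShiftIso n).app L

/-- Factoring through the homotopy category exposes the cohomology class of the cocycle, to which
the K-injectivity of `L` applies. -/
theorem homSingleOfCocycle_eq
    (f : LinearMap.ker (Linear.rightComp K A (L.d n (n + 1)))) :
    homSingleOfCocycle K A L n f = (singleFunctorIsoQh A).hom ≫
      Qh.map (CohomologyClass.toHom (.mk (cocycleOfSingle K A L n f))) ≫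
        (qhShiftIso L n).hom := by
  change _ ≫ _ ≫ _ = _
  rw [← NatIso.naturality_1 (quotientCompQhIso C)]
  simp only [Category.assoc, qhShiftIso, singleFunctorIsoQh, Iso.trans_hom]
  rfl

variable [L.IsKInjective]

/-- For K-injective `L`, morphisms in the derived category are homotopy classes of morphisms of
complexes, that is, cohomology classes of the Hom complex; a cocycle out of an object in a single
degree is just one morphism into `L.X n` killed by the differential. -/
theorem homSingleOfCocycle_surjective : Function.Surjective (homSingleOfCocycle K A L n) := by
  intro x
  obtain ⟨y, hy⟩ := (CochainComplex.IsKInjective.Qh_map_bijective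
    ((HomotopyCategory.quotient _ _).obj ((CochainComplex.singleFunctor C 0).obj A))
    (L⟦n⟧)).surjective ((singleFunctorIsoQh A).inv ≫ x ≫ (qhShiftIso L n).inv)
  obtain ⟨y, rfl⟩ := (CohomologyClass.toHom_bijective _ _ _).surjective y
  obtain ⟨y, rfl⟩ := y.mk_surjective
  obtain ⟨f, hf, rfl⟩ := Cocycle.fromSingleMk_surjective y n (zero_add n) (n + 1) rfl
  refine ⟨⟨f, hf⟩, ?_⟩
  rw [homSingleOfCocycle_eq, ← Iso.eq_inv_comp, ← Iso.eq_comp_inv, Category.assoc]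
  exact hy

/-- The degree `p` is left free: unless `p + 1 = n` the differential is zero and the condition says
`f = 0`. This makes the criterion insensitive to the passage between complexes indexed by `ℤ` and by
`ℕ`, where degree `0` has no predecessor. -/
theorem homSingleOfCocycle_eq_zero_iff
    (f : LinearMap.ker (Linear.rightComp K A (L.d n (n + 1)))) :
    homSingleOfCocycle K A L n f = 0 ↔ ∃ (p : ℤ) (g : A ⟶ L.X p), g ≫ L.d p n = f.1 := by
  have h1 : homSingleOfCocycle K A L n f = 0 ↔
      cocycleOfSingle K A L n f ∈ coboundaries _ _ _ := by
    rw [← CohomologyClass.toHom_mk_eq_zero_iff, homSingleOfCocycle_eq,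
      ← (CochainComplex.IsKInjective.Qh_map_bijective
      ((HomotopyCategory.quotient _ _).obj ((CochainComplex.singleFunctor C 0).obj A))
      (L⟦n⟧)).injective.eq_iff, Functor.map_zero, ← Iso.eq_inv_comp, ← Iso.eq_comp_inv,
      Limits.comp_zero, Limits.zero_comp]
  refine h1.trans ((Cocycle.fromSingleMk_mem_coboundaries_iff f.1 (zero_add n) (n + 1) rfl f.2
    (n - 1) (by lia)).trans ?_)
  refine ⟨fun ⟨g, hg⟩ => ⟨_, g, hg⟩, fun ⟨p, g, hg⟩ => ?_⟩
  by_cases hp : p + 1 = n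
  · obtain rfl : p = n - 1 := by lia
    exact ⟨g, hg⟩
  · rw [L.shape _ _ hp, Limits.comp_zero] at hg
    exact ⟨0, by rw [← hg, Limits.zero_comp]⟩

end

section

variable (J : CochainComplex C ℕ)

/-- The terms in nonnegative degrees of the extension of a complex by zero. -/
noncomputable def _root_.CochainComplex.extendXIsoNat {C : Type*} [Category* C] [Abelian C]
    (J : CochainComplex C ℕ) (i : ℕ) :
    (J.extend ComplexShape.embeddingUpNat).X (i : ℤ) ≅ J.X i :=
  J.extendXIso ComplexShape.embeddingUpNat (i := i) rfl

theorem _root_.CochainComplex.extend_embeddingUpNat_d {C : Type*} [Category* C] [Abelian C]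
    (J : CochainComplex C ℕ) (i j : ℕ) :
    (J.extend ComplexShape.embeddingUpNat).d (i : ℤ) (j : ℤ) =
      (extendXIsoNat J i).hom ≫ J.d i j ≫ (extendXIsoNat J j).inv :=
  HomologicalComplex.extend_d_eq _ _ rfl rfl

open ComplexShape in
theorem _root_.CochainComplex.isKInjective_extend_embeddingUpNat {C : Type*} [Category* C]
    [Abelian C] (J : CochainComplex C ℕ) [∀ i, Injective (J.X i)] :
    CochainComplex.IsKInjective (J.extend embeddingUpNat) := by
  have (n : ℤ) : Injective ((J.extend embeddingUpNat).X n) := by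
    by_cases hn : 0 ≤ n
    · obtain ⟨k, rfl⟩ := Int.eq_ofNat_of_zero_le hn
      exact Injective.of_iso (J.extendXIso embeddingUpNat rfl).symm inferInstance
    · exact IsZero.injective (CochainComplex.isZero_of_isStrictlyGE _ 0 _ (by lia))
  exact isKInjective_of_injective _ 0

attribute [local instance] CochainComplex.isKInjective_extend_embeddingUpNat

open ComplexShape

variable (A : C) (n : ℕ)

/-- The morphism `A ⟶ J[n]` in the derived category given by a cocycle `f : A ⟶ J.X n`. -/
noncomputable def homSingleExtendOfCocycle :
    LinearMap.ker (Linear.rightComp K A (J.d n (n + 1))) →ₗ[K]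
      ((singleFunctor C 0).obj A ⟶ (Q.obj (J.extend embeddingUpNat))⟦(n : ℤ)⟧) :=
  homSingleOfCocycle K A (J.extend embeddingUpNat) n ∘ₗ
    LinearMap.codRestrict _ (Linear.rightComp K A (extendXIsoNat J n).inv ∘ₗ
      Submodule.subtype _) (fun f => by
        have hf : f.1 ≫ J.d n (n + 1) = 0 := f.2
        change (f.1 ≫ (extendXIsoNat J n).inv) ≫
          (J.extend embeddingUpNat).d (n : ℤ) ((n + 1 : ℕ) : ℤ) = 0
        rw [extend_embeddingUpNat_d, Category.assoc, Iso.inv_hom_id_assoc, reassoc_of% hf,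
          Limits.zero_comp])

variable [∀ i, Injective (J.X i)]

theorem homSingleExtendOfCocycle_surjective :
    Function.Surjective (homSingleExtendOfCocycle K J A n) := by
  intro x
  obtain ⟨⟨f, hf⟩, rfl⟩ := homSingleOfCocycle_surjective K A (J.extend embeddingUpNat) n x
  refine ⟨⟨f ≫ (extendXIsoNat J n).hom, ?_⟩, ?_⟩
  · replace hf : f ≫ (J.extend embeddingUpNat).d (n : ℤ) ((n + 1 : ℕ) : ℤ) = 0 := hf
    rw [extend_embeddingUpNat_d, ← Category.assoc, ← Category.assoc,
      Preadditive.IsIso.comp_right_eq_zero] at hf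
    exact hf
  · apply congrArg (homSingleOfCocycle K A (J.extend embeddingUpNat) n)
    apply Subtype.ext
    change (f ≫ (extendXIsoNat J n).hom) ≫
      (extendXIsoNat J n).inv = f
    rw [Category.assoc, Iso.hom_inv_id, Category.comp_id]

theorem homSingleExtendOfCocycle_eq_zero_iff
    (f : LinearMap.ker (Linear.rightComp K A (J.d n (n + 1)))) :
    homSingleExtendOfCocycle K J A n f = 0 ↔
      ∃ (p : ℕ) (g : A ⟶ J.X p), g ≫ J.d p n = f.1 := by
  refine (homSingleOfCocycle_eq_zero_iff K A (J.extend embeddingUpNat) n _).trans ?_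
  change (∃ (p : ℤ) (g : A ⟶ (J.extend embeddingUpNat).X p),
    g ≫ (J.extend embeddingUpNat).d p n =
      f.1 ≫ (extendXIsoNat J n).inv) ↔ _
  constructor
  · rintro ⟨p, g, hg⟩
    by_cases hp : 0 ≤ p
    · obtain ⟨k, rfl⟩ := Int.eq_ofNat_of_zero_le hp
      refine ⟨k, g ≫ (extendXIsoNat J k).hom, ?_⟩
      rw [extend_embeddingUpNat_d, ← Category.assoc, ← Category.assoc, cancel_mono] at hg
      exact hg
    · rw [(CochainComplex.isZero_of_isStrictlyGE _ 0 p (by lia)).eq_of_tgt g 0, Limits.zero_comp,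
        eq_comm, Preadditive.IsIso.comp_right_eq_zero] at hg
      exact ⟨n, 0, by rw [hg, Limits.zero_comp]⟩
  · rintro ⟨p, g, hg⟩
    refine ⟨p, g ≫ (extendXIsoNat J p).inv, ?_⟩
    rw [extend_embeddingUpNat_d, Category.assoc, Iso.inv_hom_id_assoc, ← hg, Category.assoc]

/-- Shifted morphisms in derived categories from objects of the hearts to two complexes of
injectives are isomorphic if the complexes of morphisms are. -/
theorem nonempty_hom_extend_linearEquiv {C' : Type*} [Category* C'] [Abelian C']
    [HasDerivedCategory.{w'} C'] [Linear K C'] (J' : CochainComplex C' ℕ)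
    [∀ i, Injective (J'.X i)] (A' : C') (e : ∀ i, (A ⟶ J.X i) ≃ₗ[K] (A' ⟶ J'.X i))
    (he : ∀ i j (f : A ⟶ J.X i), e j (f ≫ J.d i j) = e i f ≫ J'.d i j) :
    Nonempty (((singleFunctor C 0).obj A ⟶ (Q.obj (J.extend embeddingUpNat))⟦(n : ℤ)⟧) ≃ₗ[K]
      ((singleFunctor C' 0).obj A' ⟶ (Q.obj (J'.extend embeddingUpNat))⟦(n : ℤ)⟧)) := by
  let e1 : LinearMap.ker (Linear.rightComp K A (J.d n (n + 1))) ≃ₗ[K]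
      LinearMap.ker (Linear.rightComp K A' (J'.d n (n + 1))) :=
    (e n).ofSubmodules _ _ (by
      ext x
      obtain ⟨x, rfl⟩ := (e n).surjective x
      rw [Submodule.mem_map_equiv, LinearEquiv.symm_apply_apply]
      change x ≫ J.d n (n + 1) = 0 ↔ e n x ≫ J'.d n (n + 1) = 0
      rw [← he, map_eq_zero_iff _ (e (n + 1)).injective])
  refine ⟨((homSingleExtendOfCocycle K J A n).quotKerEquivOfSurjective
      (homSingleExtendOfCocycle_surjective K J A n)).symm ≪≫ₗ
    Submodule.Quotient.equiv _ _ e1 ?_ ≪≫ₗ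
    (homSingleExtendOfCocycle K J' A' n).quotKerEquivOfSurjective
      (homSingleExtendOfCocycle_surjective K J' A' n)⟩
  ext x
  obtain ⟨x, rfl⟩ := e1.surjective x
  rw [Submodule.mem_map_equiv, LinearEquiv.symm_apply_apply, LinearMap.mem_ker, LinearMap.mem_ker,
    homSingleExtendOfCocycle_eq_zero_iff, homSingleExtendOfCocycle_eq_zero_iff]
  change (∃ (p : ℕ) (g : A ⟶ J.X p), g ≫ J.d p n = x.1) ↔
    ∃ (p : ℕ) (g : A' ⟶ J'.X p), g ≫ J'.d p n = e n x.1
  refine exists_congr fun p => ⟨fun ⟨g, hg⟩ => ⟨e p g, by rw [← he, hg]⟩, fun ⟨g, hg⟩ => ?_⟩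
  obtain ⟨g, rfl⟩ := (e p).surjective g
  exact ⟨g, (e n).injective (by rw [he, hg])⟩

/-- `Ext` as shifted morphisms in the derived category to an injective resolution. -/
noncomputable def extLinearEquivHomResolution {B : C} [HasExt.{v} C]
    (R : InjectiveResolution B) :
    Abelian.Ext A B n ≃ₗ[K]
      ((singleFunctor C 0).obj A ⟶ (Q.obj R.cochainComplex)⟦(n : ℤ)⟧) :=
  Abelian.Ext.homLinearEquiv ≪≫ₗ Linear.homCongr K (Iso.refl _)
    ((CategoryTheory.shiftFunctor _ (n : ℤ)).mapIso
      ((singleFunctorIsoCompQ C 0).app B ≪≫ asIso (Q.map R.ι')))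

/-- The homology of a complex indexed by `ℕ` in the derived category. -/
noncomputable def homologyExtendIso (q : ℕ) :
    (homologyFunctor C (q : ℤ)).obj (Q.obj (J.extend embeddingUpNat)) ≅ J.homology q :=
  (homologyFunctorFactors C (q : ℤ)).app _ ≪≫ J.extendHomologyIso embeddingUpNat rfl

end

end DerivedCategory

/-! ### The Grothendieck spectral sequence -/

theorem ConvergesTo.of_linearEquiv {K : Type u} [Field K]
    {E : E₂CohomologicalSpectralSequenceNat (ModuleCat.{u} K)} {H H' : ℕ → ModuleCat.{u} K}
    (h : ConvergesTo E H) (e : ∀ n, Nonempty (H n ≃ₗ[K] H' n)) : ConvergesTo E H' := by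
  intro n
  obtain ⟨F, hF, h0, hn, hE⟩ := h n
  obtain ⟨e⟩ := e n
  refine ⟨fun p => (F p).map e.toLinearMap, fun p q hpq => Submodule.map_mono (hF hpq), ?_, ?_,
    fun p q hpq => ?_⟩
  · dsimp only
    rw [h0, Submodule.map_top, LinearEquiv.range]
  · dsimp only
    rw [hn, Submodule.map_bot]
  · obtain ⟨f⟩ := hE p q hpq
    refine ⟨(Submodule.Quotient.equiv _ _ (e.submoduleMap (F p)) ?_).symm ≪≫ₗ f⟩
    ext x
    obtain ⟨x, rfl⟩ := (e.submoduleMap (F p)).surjective x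
    rw [Submodule.mem_map_equiv, LinearEquiv.symm_apply_apply]
    change x.1 ∈ F (p + 1) ↔ e x.1 ∈ (F (p + 1)).map e.toLinearMap
    exact ⟨fun h => ⟨x.1, h, rfl⟩, fun ⟨y, hy, h⟩ => e.injective h ▸ hy⟩

namespace CategoryTheory

open _root_.DerivedCategory Limits ComplexShape

/-- The Grothendieck spectral sequence `Extᵖ(B, R^q G M) ⇒ Extⁿ(A, M)` of an additive functor `G`
preserving injective objects such that `Hom(B, G -) ≅ Hom(A, -)`. -/
theorem exists_grothendieck_spectralSequence {K : Type u} [Field K]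
    {C : Type*} [Category.{u} C] [Abelian C] [Linear K C] [EnoughInjectives C] [HasExt.{u} C]
    {D : Type*} [Category.{u} D] [Abelian D] [Linear K D] [EnoughProjectives D] [HasExt.{u} D]
    (G : C ⥤ D) [G.Additive] [G.PreservesInjectiveObjects] (A : C) (B : D)
    (e : ∀ N : C, (B ⟶ G.obj N) ≃ₗ[K] (A ⟶ N))
    (he : ∀ {N N' : C} (g : N ⟶ N') (f : B ⟶ G.obj N), e N' (f ≫ G.map g) = e N f ≫ g) (M : C) :
    ∃ E : E₂CohomologicalSpectralSequenceNat (ModuleCat.{u} K),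
      (∀ p q : ℕ, Nonempty ((E.page 2 Int.two_le_two).X (p, q) ≅
        ModuleCat.of K (Abelian.Ext B ((G.rightDerived q).obj M) p))) ∧
      ConvergesTo E (fun n => ModuleCat.of K (Abelian.Ext A M n)) := by
  let := HasDerivedCategory.standard C
  let := HasDerivedCategory.standard D
  let R := InjectiveResolution.of M
  -- The homology of `J` is the right derived functor of `G` at `M`; its terms are injective since
  -- `G` preserves injectives, so morphisms from `B` into its shifts are computed by cocycles.
  let J := (G.mapHomologicalComplex (ComplexShape.up ℕ)).obj R.cocomplex
  have hJ (i : ℕ) : Injective (J.X i) :=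
    inferInstanceAs (Injective (G.obj (R.cocomplex.X i)))
  let X : DerivedCategory D := Q.obj (J.extend embeddingUpNat)
  have : X.IsGE 0 := inferInstance
  refine ⟨(homSpectralObject K B X).E₂SpectralSequenceNat, fun p q => ?_,
    (homSpectralObject K B X).convergesTo.of_linearEquiv fun n => ?_⟩
  · obtain ⟨e2⟩ := nonempty_homSpectralObject_page_two K B X p q
    let e3 : (homologyFunctor D (q : ℤ)).obj X ≅ (G.rightDerived q).obj M :=
      homologyExtendIso J q ≪≫ (R.isoRightDerivedObj G q).symm
    exact ⟨e2 ≪≫ (Abelian.Ext.homLinearEquiv ≪≫ₗ Linear.homCongr K (Iso.refl _)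
      ((shiftFunctor _ (p : ℤ)).mapIso ((singleFunctor D 0).mapIso e3)) ≪≫ₗ
      Abelian.Ext.homLinearEquiv.symm).toModuleIso⟩
  · obtain ⟨e1⟩ := nonempty_hom_extend_linearEquiv K J B n R.cocomplex A
      (fun i => e (R.cocomplex.X i)) (fun i j f => he (R.cocomplex.d i j) f)
    exact ⟨(homSpectralObjectAbutmentEquiv K B X n).symm ≪≫ₗ e1 ≪≫ₗ
      (extLinearEquivHomResolution K A n R).symm⟩

end CategoryTheory

/-! ### Von Neumann regularity and flatness -/

/-- In a commutative von Neumann regular ring, finitely many elements are fixed by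
multiplication by a suitable element of the ideal they generate. -/
theorem Ideal.exists_mem_span_image_mul_eq_self {R : Type*} [CommRing R]
    (hR : ∀ x : R, ∃ y, x * y * x = x) {ι : Type*} (f : ι → R) (s : Finset ι) :
    ∃ e ∈ Ideal.span (f '' s), ∀ i ∈ s, e * f i = f i := by
  classical
  induction s using Finset.induction_on with
  | empty => exact ⟨0, zero_mem _, by simp⟩
  | insert k s _ ih =>
    obtain ⟨e, he, h⟩ := ih
    obtain ⟨y, hy⟩ := hR (f k)
    -- This is `1 - (1 - e) * (1 - y * f k)`: the factor `1 - e` kills the earlier elements and `1 -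
    -- y * f k` kills `f k`.
    refine ⟨e + (1 - e) * y * f k, add_mem (Ideal.span_mono (by gcongr; simp) he)
      (Ideal.mul_mem_left _ _ (Ideal.subset_span ⟨k, by simp, rfl⟩)), fun i hi => ?_⟩
    rcases Finset.mem_insert.1 hi with rfl | hi
    · linear_combination (1 - e) * hy
    · linear_combination (1 - y * f k) * h i hi

/-- Every module over a commutative von Neumann regular ring is flat. -/
theorem Module.Flat.of_forall_exists_mul_mul_eq_self {R : Type*} [CommRing R]
    (hR : ∀ x : R, ∃ y, x * y * x = x) (M : Type*) [AddCommGroup M] [Module R M] :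
    Module.Flat R M := by
  rw [Module.Flat.iff_forall_isTrivialRelation]
  intro l f x h
  obtain ⟨e, he, hf⟩ := Ideal.exists_mem_span_image_mul_eq_self hR f Finset.univ
  rw [Finset.coe_univ, Set.image_univ, Ideal.mem_span_range_iff_exists_fun] at he
  obtain ⟨r, rfl⟩ := he
  -- With `e = ∑ r i * f i`, the matrix `1 - (r i * f j)` fixes the vector `x` because `∑ f j • x j
  -- = 0`, and it is annihilated by `f` on the left because `e * f j = f j`.
  refine ⟨l, fun i j => (if i = j then 1 else 0) - r i * f j, x, fun i => ?_, fun j => ?_⟩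
  · simp only [sub_smul, ite_smul, one_smul, zero_smul, Finset.sum_sub_distrib, mul_smul,
      ← Finset.smul_sum, h, smul_zero, sub_zero, Finset.sum_ite_eq, Finset.mem_univ, if_true]
  · simp only [mul_sub, mul_ite, mul_one, mul_zero, Finset.sum_sub_distrib, Finset.sum_ite_eq',
      Finset.mem_univ, if_true]
    rw [sub_eq_zero]
    conv_lhs => rw [← hf j (Finset.mem_univ j), Finset.sum_mul]
    exact Finset.sum_congr rfl fun i _ => by ring

/-- The algebra of a commutative monoid of idempotents over a field is von Neumann regular. -/
theorem MonoidAlgebra.exists_mul_mul_eq_self {K E : Type*} [Field K] [CommMonoid E]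
    (hE : ∀ e : E, e * e = e) (x : MonoidAlgebra K E) : ∃ y, x * y * x = x := by
  -- The scalar shift `k` strengthens the induction: multiplied by an idempotent `w`, the element `c
  -- w + x + k` becomes `x + (c + k)`, and multiplied by `1 - w` it becomes `x + k`.
  suffices h : ∀ k : K, ∃ y, (x + algebraMap K _ k) * y * (x + algebraMap K _ k) =
      x + algebraMap K _ k by simpa using h 0
  induction x using MonoidAlgebra.induction with
  | zero =>
    intro k
    by_cases hk : k = 0
    · exact ⟨0, by simp [hk]⟩
    · refine ⟨algebraMap K _ k⁻¹, ?_⟩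
      rw [zero_add, ← map_mul, mul_inv_cancel₀ hk, map_one, one_mul]
  | single_add e c x _ _ ih =>
    intro k
    obtain ⟨y, hy⟩ := ih (c + k)
    obtain ⟨z, hz⟩ := ih k
    set w : MonoidAlgebra K E := MonoidAlgebra.of K E e with hw
    have hww : w * w = w := by rw [hw, ← map_mul, hE]
    have hs : MonoidAlgebra.single e c = algebraMap K _ c * w := by
      rw [hw, ← Algebra.smul_def, MonoidAlgebra.of_apply, MonoidAlgebra.smul_single, smul_eq_mul,
        mul_one]
    rw [map_add] at hy
    -- Quasi-inverses on the two factors cut out by `w` and `1 - w` are glued.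
    refine ⟨w * y + (1 - w) * z, ?_⟩
    rw [hs]
    generalize algebraMap K (MonoidAlgebra K E) c = c at *
    generalize algebraMap K (MonoidAlgebra K E) k = k at *
    grind

/-! ### Idempotents and generators of the crossed product -/

namespace InverseMonoid

variable (S : Type*) [InverseMonoid S]

/-- The commutative submonoid of idempotents of an inverse monoid. -/
def idemSubmonoid : Submonoid S where
  carrier := {e | e * e = e}
  one_mem' := mul_one 1
  mul_mem' := idem_mul

instance : CommMonoid (idemSubmonoid S) where
  mul_comm e f := Subtype.ext (idem_comm e.2 f.2)

-- An idempotent moves from the right of `s` to its left by conjugation. This is what makes the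
-- diagonal action of `S` on `Λ ⊗ V` compatible with the balancing relation.
variable {S} in
theorem mul_idem_eq {e : S} (he : e * e = e) (s : S) : s * e = s * e * s⁻¹ * s := by
  rw [mul_assoc, mul_assoc, idem_comm he (inv_mul_idem s), ← mul_assoc, ← mul_assoc, mul_inv_mul]

theorem conj_idem {e : S} (he : e * e = e) (s : S) :
    (s * e * s⁻¹) * (s * e * s⁻¹) = s * e * s⁻¹ :=
  (s • (show Idem S from ⟨e, he⟩)).2

end InverseMonoid

namespace UnitalAction

open InverseMonoid

section

variable {K S A : Type*} [CommRing K] [InverseMonoid S] [Ring A] [Algebra K A]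
variable (θ : UnitalAction K S A)

theorem act_of_idem {e : S} (he : e * e = e) (a : A) : θ.act e a = θ.unit e * a := by
  have h := θ.act_act_inv e a
  rwa [inv_of_idem he, ← act_comp, he] at h

theorem unit_idem_mul {e : S} (he : e * e = e) (t : S) :
    θ.unit (e * t) = θ.unit e * θ.unit t := by
  rw [← act_unit, act_comp, act_of_idem θ he, act_unit]

theorem incl_unit_mul_delta (s : S) : θ.incl (θ.unit s) * θ.delta s = θ.delta s := by
  have h := θ.incl_unit_mul s 1
  rwa [mul_one, _root_.map_one, one_mul] at h

theorem coe_inclL_mul_deltaL (s : S) (a : A) :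
    ((θ.inclL a * θ.deltaL s : θ.skewSum) : S →₀ A) = Finsupp.single s (a * θ.unit s) := by
  change θ.mulAux (Finsupp.single 1 a) (Finsupp.single s (θ.unit s)) = _
  rw [mulAux_single, act_one, one_mul]

theorem quot_eq_iff (x y : θ.skewSum) : θ.quot x = θ.quot y ↔ x - y ∈ θ.ideal :=
  (RingCon.eq _).trans (TwoSidedIdeal.rel_iff _ _ _)

theorem quot_surjective : Function.Surjective θ.quot := Quotient.mk_surjective

/-- Since `e ≤ 1`, the element `1_e δ_e - 1_e δ_1` is a generator of `𝒩`. Consequently whatever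
commutes with `A` commutes with every `δ_e`. -/
theorem delta_of_idem {e : S} (he : e * e = e) : θ.delta e = θ.incl (θ.unit e) := by
  have h : θ.quot (θ.inclL (θ.unit e) * θ.deltaL e) =
      θ.quot (θ.inclL (θ.unit e) * θ.deltaL 1) := by
    rw [quot_eq_iff]
    refine TwoSidedIdeal.subset_span ⟨e, 1, θ.unit e, ⟨e, he, (mul_one e).symm⟩, θ.unit_idem e, ?_⟩
    rw [AddSubgroupClass.coe_sub, coe_inclL_mul_deltaL, coe_inclL_mul_deltaL, θ.unit_idem,
      θ.unit_one, mul_one]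
  rw [_root_.map_mul, _root_.map_mul, _root_.map_one, _root_.map_one, mul_one] at h
  exact (θ.incl_unit_mul_delta e).symm.trans h

theorem incl_mul_delta_idem {e : S} (he : e * e = e) (a : A) :
    θ.incl a * θ.delta e = θ.delta e * θ.incl a := by
  rw [delta_of_idem θ he, ← _root_.map_mul, ← _root_.map_mul, unit_central]

theorem delta_mul_incl_unit_inv (s : S) : θ.delta s * θ.incl (θ.unit s⁻¹) = θ.delta s := by
  rw [delta_mul_incl, ← θ.act_unit s⁻¹, act_act_inv, mul_one, incl_unit_mul_delta]

theorem sum_single_mem (f : θ.skewSum) :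
    f = ∑ s ∈ f.1.support, θ.inclL (f.1 s) * θ.deltaL s := by
  apply Subtype.ext
  rw [AddSubmonoidClass.coe_finsetSum]
  conv_lhs => rw [← Finsupp.sum_single f.1, Finsupp.sum]
  refine Finset.sum_congr rfl fun s _ => ?_
  rw [coe_inclL_mul_deltaL, ← unit_central, f.2 s]

/-- The crossed product is generated, as an additive group, by the elements `a δ_s`. -/
theorem crossedProduct_induction {P : θ.CrossedProduct → Prop} (x : θ.CrossedProduct)
    (zero : P 0) (add : ∀ x y, P x → P y → P (x + y))
    (mul : ∀ a s, P (θ.incl a * θ.delta s)) : P x := by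
  obtain ⟨x, rfl⟩ := θ.quot_surjective x
  rw [θ.sum_single_mem x, _root_.map_sum]
  refine Finset.sum_induction _ P add zero fun s _ => ?_
  rw [_root_.map_mul]
  exact mul _ _

end

end UnitalAction

/-! ### Bimodules and their invariants -/

namespace Envelope

section

variable (K : Type*) {R M : Type*} [CommRing K] [Ring R] [Algebra K R]
  [AddCommGroup M] [Module (Envelope K R) M]

/-- The left action of `R` on a left `Rᵉ`-module. -/
noncomputable def lact (x : R) (m : M) : M := (x ⊗ₜ[K] (1 : Rᵐᵒᵖ) : Envelope K R) • m

/-- The right action of `R` on a left `Rᵉ`-module. -/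
noncomputable def ract (m : M) (x : R) : M := ((1 : R) ⊗ₜ[K] op x : Envelope K R) • m

theorem tmul_smul (x : R) (y : Rᵐᵒᵖ) (m : M) :
    (x ⊗ₜ[K] y : Envelope K R) • m = lact K x (ract K m y.unop) := by
  rw [lact, ract, smul_smul, Algebra.TensorProduct.tmul_mul_tmul, one_mul, mul_one, op_unop]

theorem lact_mul (x y : R) (m : M) : lact K (x * y) m = lact K x (lact K y m) := by
  rw [lact, lact, lact, smul_smul, Algebra.TensorProduct.tmul_mul_tmul, mul_one]

theorem ract_mul (x y : R) (m : M) : ract K m (x * y) = ract K (ract K m x) y := by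
  rw [ract, ract, ract, smul_smul, Algebra.TensorProduct.tmul_mul_tmul, mul_one, op_mul]

theorem ract_lact (x y : R) (m : M) : ract K (lact K x m) y = lact K x (ract K m y) := by
  rw [lact, ract, lact, ract, smul_smul, smul_smul, Algebra.TensorProduct.tmul_mul_tmul,
    Algebra.TensorProduct.tmul_mul_tmul, mul_one, one_mul, mul_one, one_mul]

@[simp] theorem lact_one (m : M) : lact K (1 : R) m = m := one_smul (Envelope K R) m

@[simp] theorem ract_one (m : M) : ract K m (1 : R) = m := one_smul (Envelope K R) m

theorem lact_add (x : R) (m n : M) : lact K x (m + n) = lact K x m + lact K x n := smul_add _ _ _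

theorem ract_add (x : R) (m n : M) : ract K (m + n) x = ract K m x + ract K n x := smul_add _ _ _

@[simp] theorem lact_zero (x : R) : lact K x (0 : M) = 0 := smul_zero _

@[simp] theorem ract_zero (x : R) : ract K (0 : M) x = 0 := smul_zero _

theorem add_lact (x y : R) (m : M) : lact K (x + y) m = lact K x m + lact K y m := by
  rw [lact, add_tmul, add_smul]; rfl

theorem ract_add_right (x y : R) (m : M) : ract K m (x + y) = ract K m x + ract K m y := by
  have h : ((1 : R) ⊗ₜ[K] op (x + y) : Envelope K R) = 1 ⊗ₜ[K] op x + 1 ⊗ₜ[K] op y :=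
    tmul_add _ _ _
  rw [ract, h, add_smul]; rfl

@[simp] theorem zero_lact (m : M) : lact K (0 : R) m = 0 := by
  rw [lact, zero_tmul]; exact zero_smul (Envelope K R) m

@[simp] theorem ract_zero_right (m : M) : ract K m (0 : R) = 0 := by
  rw [ract, op_zero, tmul_zero]; exact zero_smul (Envelope K R) m

theorem ract_smul_right [Module K M] [IsScalarTower K (Envelope K R) M] (r : K) (x : R) (m : M) :
    ract K m (r • x) = r • ract K m x := by
  rw [ract, op_smul, TensorProduct.tmul_smul, smul_assoc]; rfl

theorem lact_smul [Module K M] [IsScalarTower K (Envelope K R) M] (r : K) (x : R) (m : M) :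
    lact K x (r • m) = r • lact K x m := smul_comm _ _ _

theorem ract_smul [Module K M] [IsScalarTower K (Envelope K R) M] (r : K) (x : R) (m : M) :
    ract K (r • m) x = r • ract K m x := smul_comm _ _ _

end

section Regular

variable {K R : Type u} [Field K] [Ring R] [Algebra K R]

theorem lact_hom {M N : ModuleCat.{u} (Envelope K R)} (g : M ⟶ N) (x : R) (m : M) :
    g.hom (lact K x m) = lact K x (g.hom m) := g.hom.map_smul _ _

theorem ract_hom {M N : ModuleCat.{u} (Envelope K R)} (g : M ⟶ N) (x : R) (m : M) :
    g.hom (ract K m x) = ract K (g.hom m) x := g.hom.map_smul _ _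

variable (K) in
/-- An element of `R` as an element of the regular bimodule. -/
noncomputable def toRegularBimodule (y : R) : regularBimodule K R := y

theorem lact_toRegularBimodule (x y : R) :
    lact K x (toRegularBimodule K y) = toRegularBimodule K (x * y) :=
  congrArg (x * ·) (mul_one y)

theorem ract_toRegularBimodule (x y : R) :
    ract K (toRegularBimodule K y) x = toRegularBimodule K (y * x) :=
  one_mul (y * x)

variable (M : ModuleCat.{u} (Envelope K R))

/-- The elements `m` of a bimodule such that `x m = m x` for all `x`. -/
noncomputable def invariants : Submodule K M where
  carrier := {m | ∀ x : R, lact K x m = ract K m x}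
  add_mem' hm hn x := by rw [lact_add, ract_add, hm, hn]
  zero_mem' x := by rw [lact_zero, ract_zero]
  smul_mem' r m hm x := by rw [lact_smul, ract_smul, hm]

/-- The homomorphism of bimodules `R ⟶ M` given by an invariant of `M`. -/
noncomputable def regularBimoduleHomMk (m : invariants M) : regularBimodule K R ⟶ M :=
  ModuleCat.ofHom (X := regularBimodule K R) (Y := M)
    { toFun (y : regularBimodule K R) := lact K (show R from y) m.1
      map_add' x y := add_lact K _ _ m.1
      map_smul' z (y : R) := by
        induction z using TensorProduct.induction_on with
        | zero =>
          refine (congrArg (fun w : R => lact K w m.1)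
            (zero_smul (Envelope K R) (toRegularBimodule K y))).trans ?_
          exact (zero_lact K m.1).trans (zero_smul (Envelope K R) (lact K y m.1)).symm
        | add z z' hz hz' =>
          refine (congrArg (fun w : R => lact K w m.1)
            (add_smul z z' (toRegularBimodule K y))).trans ?_
          exact (add_lact K _ _ m.1).trans ((congrArg₂ _ hz hz').trans (add_smul z z' _).symm)
        | tmul a b =>
          change lact K (a * (y * b.unop)) m.1 = (a ⊗ₜ[K] b : Envelope K R) • lact K y m.1
          rw [lact_mul, lact_mul, m.2, Envelope.tmul_smul, ract_lact] }

theorem hom_toRegularBimodule_one_mem (g : regularBimodule K R ⟶ M) :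
    g.hom (toRegularBimodule K 1) ∈ invariants M := fun x => by
  rw [← lact_hom, ← ract_hom, lact_toRegularBimodule, ract_toRegularBimodule, mul_one, one_mul]

variable {M} in
theorem regularBimodule_hom_ext {g g' : regularBimodule K R ⟶ M}
    (h : g.hom (toRegularBimodule K 1) = g'.hom (toRegularBimodule K 1)) : g = g' := by
  ext (y : R)
  change g.hom (toRegularBimodule K y) = g'.hom (toRegularBimodule K y)
  rw [← mul_one y, ← lact_toRegularBimodule, lact_hom, lact_hom, h]

/-- Homomorphisms of bimodules `R ⟶ M` are the invariants of `M`. -/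
noncomputable def regularBimoduleHomEquiv :
    (regularBimodule K R ⟶ M) ≃ₗ[K] invariants M where
  toFun g := ⟨_, hom_toRegularBimodule_one_mem M g⟩
  map_add' _ _ := rfl
  map_smul' _ _ := rfl
  invFun := regularBimoduleHomMk M
  left_inv _ := regularBimodule_hom_ext (lact_one K _)
  right_inv m := Subtype.ext (lact_one K m.1)

end Regular

end Envelope

/-! ### Evaluation at `1` on `Hom_{Aᵉ}(A, M)` -/

namespace UnitalAction

open InverseMonoid Envelope

section HomAe

attribute [local instance] instModuleTensorProductMop

variable {K S A : Type*} [Field K] [InverseMonoid S] [Ring A] [Algebra K A]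
variable (θ : UnitalAction K S A)
variable {M : Type*} [AddCommGroup M] [Module (Envelope K θ.CrossedProduct) M]

/-- The bimodule `A` is generated by `1`, from the left alone and likewise from the right alone.
Comparing the two descriptions shows that `f 1` commutes with `A`. -/
theorem homAe_apply (f : θ.HomAe M) (a : A) : f a = lact K (θ.incl a) (f 1) := by
  have h : (a ⊗ₜ[K] (1 : Aᵐᵒᵖ) : Envelope K A) • (1 : A) = a :=
    (congrArg (a * ·) (mul_one 1)).trans (mul_one a)
  conv_lhs => rw [← h, LinearMap.map_smulₛₗ]
  change (θ.incl a ⊗ₜ[K] op (θ.incl 1) : Envelope K θ.CrossedProduct) • _ = _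
  rw [_root_.map_one]
  rfl

theorem homAe_apply' (f : θ.HomAe M) (a : A) : f a = ract K (f 1) (θ.incl a) := by
  have h : ((1 : A) ⊗ₜ[K] op a : Envelope K A) • (1 : A) = a :=
    (one_mul (1 * a)).trans (one_mul a)
  conv_lhs => rw [← h, LinearMap.map_smulₛₗ]
  change (θ.incl 1 ⊗ₜ[K] op (θ.incl a) : Envelope K θ.CrossedProduct) • _ = _
  rw [_root_.map_one]
  rfl

theorem lact_homAe_one (f : θ.HomAe M) (a : A) :
    lact K (θ.incl a) (f 1) = ract K (f 1) (θ.incl a) :=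
  (θ.homAe_apply f a).symm.trans (θ.homAe_apply' f a)

theorem homAe_ext {f g : θ.HomAe M} (h : f 1 = g 1) : f = g :=
  LinearMap.ext fun a =>
    (θ.homAe_apply f a).trans ((congrArg _ h).trans (θ.homAe_apply g a).symm)

/-- The element of `Hom_{Aᵉ}(A, M)` with value `m` at `1`. -/
noncomputable def homAeMk (m : M)
    (hm : ∀ a, lact K (θ.incl a) m = ract K m (θ.incl a)) : θ.HomAe M where
  toFun a := lact K (θ.incl a) m
  map_add' a b := by rw [_root_.map_add, add_lact]
  map_smul' z a := by
    induction z using TensorProduct.induction_on with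
    | zero =>
      refine (congrArg (fun w : A => lact K (θ.incl w) m) (zero_smul (Envelope K A) a)).trans ?_
      rw [_root_.map_zero, zero_lact, _root_.map_zero]
      exact (zero_smul (Envelope K θ.CrossedProduct) (lact K (θ.incl a) m)).symm
    | add z z' hz hz' =>
      rw [add_smul, _root_.map_add, add_lact, hz, hz', _root_.map_add, add_smul]
    | tmul b c =>
      change lact K (θ.incl (b * (a * c.unop))) m =
        (θ.incl b ⊗ₜ[K] op (θ.incl c.unop) : Envelope K θ.CrossedProduct) • lact K (θ.incl a) m
      rw [_root_.map_mul, _root_.map_mul, lact_mul, lact_mul, hm, Envelope.tmul_smul, ract_lact,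
        unop_op]

@[simp] theorem homAeMk_one (m : M) (hm : ∀ a, lact K (θ.incl a) m = ract K m (θ.incl a)) :
    θ.homAeMk m hm 1 = m := by
  change lact K (θ.incl 1) m = m
  rw [_root_.map_one, lact_one]

variable [Module K M] [IsScalarTower K (Envelope K θ.CrossedProduct) M]

/-- The unit `1_{s⁻¹} = s⁻¹ · 1` at which `f` is evaluated is absorbed by `δ_s`, so that only
conjugation remains. -/
theorem homRep_apply_one (s : S) (f : θ.HomAe M) :
    θ.homRep M s f 1 = lact K (θ.delta s) (ract K (f 1) (θ.delta s⁻¹)) := by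
  change θ.conj s • f (θ.act s⁻¹ 1) = _
  rw [homAe_apply, act_unit]
  change (θ.delta s ⊗ₜ[K] op (θ.delta s⁻¹) : Envelope K θ.CrossedProduct) • _ = _
  rw [Envelope.tmul_smul, ract_lact, ← lact_mul, delta_mul_incl_unit_inv, unop_op]

end HomAe

end UnitalAction

/-! ### Homomorphisms from `KE(S)` to `T₁ M` -/

namespace InverseMonoid

variable (K : Type u) {S : Type u} [Field K] [InverseMonoid S]

/-- The basis element of `KE(S)` attached to an idempotent. -/
noncomputable def trivialModuleSingle (e : Idem S) : trivialModule K S :=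
  (Representation.ofMulAction K S (Idem S)).asModuleEquiv.symm (MonoidAlgebra.single e 1)

theorem of_smul_trivialModuleSingle (s : S) (e : Idem S) :
    MonoidAlgebra.of K S s • trivialModuleSingle K e = trivialModuleSingle K (s • e) := by
  refine ((Representation.ofMulAction K S (Idem S)).asModuleEquiv_symm_map_rho s _).symm.trans ?_
  rw [Representation.ofMulAction_single]
  rfl

variable (S) in
/-- The idempotent `1` of `S`. -/
def idemOne : Idem S := ⟨1, mul_one 1⟩

theorem coe_smul_idemOne (s : S) : (s • idemOne S).1 = s * s⁻¹ := by
  change s * 1 * s⁻¹ = _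
  rw [mul_one]

theorem idem_smul_idemOne (e : Idem S) : e.1 • idemOne S = e :=
  Subtype.ext (by rw [coe_smul_idemOne, inv_of_idem e.2, e.2])

variable {K}

/-- The idempotent `1` generates `KE(S)`, as `e · 1 = e 1 e⁻¹ = e` for every idempotent `e`. -/
theorem trivialModule_hom_ext {V : ModuleCat.{u} (MonoidAlgebra K S)} {f g : trivialModule K S ⟶ V}
    (h : f.hom (trivialModuleSingle K (idemOne S)) = g.hom (trivialModuleSingle K (idemOne S))) :
    f = g := by
  ext (x : MonoidAlgebra K (Idem S))
  induction x using MonoidAlgebra.induction_linear with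
  | zero => exact f.hom.map_zero.trans g.hom.map_zero.symm
  | add x y hx hy =>
    exact (f.hom.map_add _ _).trans ((congrArg₂ _ hx hy).trans (g.hom.map_add _ _).symm)
  | single e r =>
    have h1 : (show trivialModule K S from MonoidAlgebra.single e r) =
        (algebraMap K (MonoidAlgebra K S) r * MonoidAlgebra.of K S e.1) •
          trivialModuleSingle K (idemOne S) := by
      rw [mul_smul, of_smul_trivialModuleSingle, idem_smul_idemOne]
      refine Eq.trans ?_
        ((Representation.ofMulAction K S (Idem S)).asModuleEquiv_symm_map_smul r _)
      rw [MonoidAlgebra.smul_single, smul_eq_mul, mul_one]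
      rfl
    refine (congrArg f.hom h1).trans (Eq.trans ?_ (congrArg g.hom h1).symm)
    rw [map_smul, map_smul, h]

end InverseMonoid

namespace UnitalAction

open InverseMonoid Envelope

variable {K S A : Type u} [Field K] [InverseMonoid S] [Ring A] [Algebra K A]
variable (θ : UnitalAction K S A)
variable (M : ModuleCat.{u} (Envelope K θ.CrossedProduct))

attribute [local instance] instModuleTensorProductMop

/-- Evaluation at `1` of an element of `T₁ M = Hom_{Aᵉ}(A, M)`. -/
noncomputable def evalOne : θ.T1.obj M →+ M where
  toFun f := (θ.homRep M).asModuleEquiv f 1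
  map_zero' := rfl
  map_add' _ _ := rfl

variable {M}

theorem evalOne_injective : Function.Injective (θ.evalOne M) := fun _ _ h =>
  (θ.homRep M).asModuleEquiv.injective (θ.homAe_ext h)

theorem evalOne_algebraMap_smul (r : K) (f : θ.T1.obj M) :
    θ.evalOne M (algebraMap K (MonoidAlgebra K S) r • f) = r • θ.evalOne M f := by
  have h : r • (θ.homRep M).asModuleEquiv f = algebraMap K (MonoidAlgebra K S) r • f :=
    (θ.homRep M).asModuleEquiv_symm_map_smul r ((θ.homRep M).asModuleEquiv f)
  exact (congrArg (θ.evalOne M) h).symm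

theorem evalOne_of_smul (s : S) (f : θ.T1.obj M) :
    θ.evalOne M (MonoidAlgebra.of K S s • f) =
      lact K (θ.delta s) (ract K (θ.evalOne M f) (θ.delta s⁻¹)) := by
  have h : θ.homRep M s ((θ.homRep M).asModuleEquiv f) = MonoidAlgebra.of K S s • f :=
    (θ.homRep M).asModuleEquiv_symm_map_rho s ((θ.homRep M).asModuleEquiv f)
  exact (congrArg (θ.evalOne M) h).symm.trans (θ.homRep_apply_one s _)

theorem lact_incl_evalOne (a : A) (f : θ.T1.obj M) :
    lact K (θ.incl a) (θ.evalOne M f) = ract K (θ.evalOne M f) (θ.incl a) :=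
  θ.lact_homAe_one _ a

/-- The element of `T₁ M` with value `m` at `1`. -/
noncomputable def t1Mk (m : M) (hm : ∀ a, lact K (θ.incl a) m = ract K m (θ.incl a)) :
    θ.T1.obj M := (θ.homRep M).asModuleEquiv.symm (θ.homAeMk m hm)

@[simp] theorem evalOne_t1Mk (m : M) (hm : ∀ a, lact K (θ.incl a) m = ract K m (θ.incl a)) :
    θ.evalOne M (θ.t1Mk m hm) = m := θ.homAeMk_one m hm

/-- A family of elements of `M` commuting with `A` gives a linear map to `T₁ M` if it
is equivariant. -/
theorem exists_linearMap_t1 {V : ModuleCat.{u} (MonoidAlgebra K S)} (φ : V →+ M)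
    (hA : ∀ a v, lact K (θ.incl a) (φ v) = ract K (φ v) (θ.incl a))
    (hK : ∀ (r : K) v, φ (algebraMap K (MonoidAlgebra K S) r • v) = r • φ v)
    (hS : ∀ s v, φ (MonoidAlgebra.of K S s • v) =
      lact K (θ.delta s) (ract K (φ v) (θ.delta s⁻¹))) :
    ∃ f : V ⟶ θ.T1.obj M, ∀ v, θ.evalOne M (f.hom v) = φ v := by
  refine ⟨ModuleCat.ofHom (Y := θ.T1.obj M)
    { toFun v := θ.t1Mk (φ v) (fun a => hA a v)
      map_add' v w := θ.evalOne_injective (by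
        rw [(θ.evalOne M).map_add, evalOne_t1Mk, evalOne_t1Mk, evalOne_t1Mk, φ.map_add])
      map_smul' x v := θ.evalOne_injective (by
        refine (θ.evalOne_t1Mk _ _).trans ?_
        change _ = θ.evalOne M (x • θ.t1Mk (φ v) (fun a => hA a v))
        induction x using MonoidAlgebra.induction_on with
        | of s => rw [hS, evalOne_of_smul, evalOne_t1Mk]
        | add x y hx hy => rw [add_smul, φ.map_add, hx, hy, add_smul, (θ.evalOne M).map_add]
        | smul r x hx =>
          rw [Algebra.smul_def, mul_smul, mul_smul, hK, hx, evalOne_algebraMap_smul]) },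
    fun v => θ.evalOne_t1Mk (φ v) _⟩

variable (M) in
theorem invariants_iff (m : M) : m ∈ invariants M ↔
    (∀ a, lact K (θ.incl a) m = ract K m (θ.incl a)) ∧
      ∀ s, lact K (θ.delta s) m = ract K m (θ.delta s) := by
  refine ⟨fun h => ⟨fun a => h _, fun s => h _⟩, fun ⟨h1, h2⟩ x => ?_⟩
  induction x using θ.crossedProduct_induction with
  | zero => rw [zero_lact, ract_zero_right]
  | add x y hx hy => rw [add_lact, ract_add_right, hx, hy]
  | mul a s => rw [lact_mul, ract_mul, h2, ← ract_lact, h1]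

/-- Since `s · 1 = (s s⁻¹) · 1` in `E(S)`, equivariance gives `δ_s m δ_{s⁻¹} = δ_{s s⁻¹} m`.
Multiplying by `δ_s` on the right and moving the idempotents `δ_{s⁻¹ s}` and `δ_{s s⁻¹}` past `m`,
where they are absorbed by `δ_s`, leaves `δ_s m = m δ_s`. -/
theorem evalOne_hom_trivialModule_mem (f : trivialModule K S ⟶ θ.T1.obj M) :
    θ.evalOne M (f.hom (trivialModuleSingle K (idemOne S))) ∈ invariants M := by
  set m := θ.evalOne M (f.hom (trivialModuleSingle K (idemOne S))) with hm
  have h1 (a : A) : lact K (θ.incl a) m = ract K m (θ.incl a) := θ.lact_incl_evalOne a _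
  have he {e : S} (he : e * e = e) : lact K (θ.delta e) m = ract K m (θ.delta e) := by
    rw [delta_of_idem θ he, h1]
  refine (θ.invariants_iff M m).2 ⟨h1, fun s => ?_⟩
  have hs (t : S) : θ.evalOne M (f.hom (trivialModuleSingle K (t • idemOne S))) =
      lact K (θ.delta t) (ract K m (θ.delta t⁻¹)) := by
    rw [← of_smul_trivialModuleSingle, _root_.map_smul, evalOne_of_smul]
  have h2 : s • idemOne S = (s * s⁻¹) • idemOne S := Subtype.ext (by
    rw [coe_smul_idemOne, coe_smul_idemOne, inv_of_idem (mul_inv_idem s), mul_inv_idem])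
  have h3 := hs s
  rw [h2, hs, inv_of_idem (mul_inv_idem s), ← he (mul_inv_idem s), ← lact_mul, ← _root_.map_mul,
    mul_inv_idem] at h3
  have h4 := congrArg (fun x => ract K x (θ.delta s)) h3
  rw [ract_lact, ract_lact, ← ract_mul, ← _root_.map_mul, ← he (inv_mul_idem s), ← lact_mul,
    ← _root_.map_mul, ← mul_assoc, mul_inv_mul, ← ract_lact, he (mul_inv_idem s), ← ract_mul,
    ← _root_.map_mul, mul_inv_mul] at h4
  exact h4.symm

/-- The map sends `e` to `δ_e m`. It is equivariant because `δ_s δ_e m δ_{s⁻¹} = δ_{s e s⁻¹} m` for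
invariant `m`. -/
theorem exists_hom_trivialModule {m : M} (hm : m ∈ invariants M) :
    ∃ f : trivialModule K S ⟶ θ.T1.obj M,
      θ.evalOne M (f.hom (trivialModuleSingle K (idemOne S))) = m := by
  let φ : MonoidAlgebra K (Idem S) →ₗ[K] M :=
    Finsupp.lsum K (fun e : Idem S => LinearMap.toSpanSingleton K M (lact K (θ.delta e.1) m)) ∘ₗ
      (MonoidAlgebra.coeffLinearEquiv K).toLinearMap
  have hφ (e : Idem S) (r : K) : φ (MonoidAlgebra.single e r) = r • lact K (θ.delta e.1) m := by
    change Finsupp.lsum K (fun e : Idem S => LinearMap.toSpanSingleton K M (lact K (θ.delta e.1) m))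
      (Finsupp.single e r) = _
    rw [Finsupp.lsum_single, LinearMap.toSpanSingleton_apply]
  obtain ⟨f, hf⟩ := θ.exists_linearMap_t1 (V := trivialModule K S) (M := M) φ.toAddMonoidHom
    (fun a v => by
      change lact K (θ.incl a) (φ v) = ract K (φ v) (θ.incl a)
      induction v using MonoidAlgebra.induction_linear with
      | zero => rw [φ.map_zero, lact_zero, ract_zero]
      | add v w hv hw => rw [φ.map_add, lact_add, hv, hw, ract_add]
      | single e r =>
        rw [hφ, lact_smul, ract_smul, ← lact_mul, incl_mul_delta_idem θ e.2, lact_mul, hm,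
          ract_lact]) (fun r v => by
      have h : r • (show MonoidAlgebra K (Idem S) from v) =
          (show trivialModule K S from algebraMap K (MonoidAlgebra K S) r • v) :=
        (Representation.ofMulAction K S (Idem S)).asModuleEquiv_symm_map_smul r v
      exact (congrArg φ h).symm.trans (φ.map_smul r v)) (fun s v => by
      have h : Representation.ofMulAction K S (Idem S) s (show MonoidAlgebra K (Idem S) from v) =
          (show trivialModule K S from MonoidAlgebra.of K S s • v) :=
        (Representation.ofMulAction K S (Idem S)).asModuleEquiv_symm_map_rho s v
      refine (congrArg φ h).symm.trans ?_
      change _ = lact K (θ.delta s) (ract K (φ v) (θ.delta s⁻¹))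
      clear h
      induction v using MonoidAlgebra.induction_linear with
      | zero =>
        rw [φ.map_zero, ract_zero, lact_zero]
        exact (congrArg φ (_root_.map_zero _)).trans φ.map_zero
      | add v w hv hw =>
        rw [φ.map_add, ract_add, lact_add, ← hv, ← hw, ← φ.map_add]
        exact congrArg φ (_root_.map_add _ _ _)
      | single e r =>
        refine (congrArg φ (Representation.ofMulAction_single s e r)).trans ?_
        rw [hφ, hφ, ract_smul, lact_smul, ract_lact, ← hm, ← lact_mul, ← lact_mul,
          ← _root_.map_mul, ← _root_.map_mul]
        rfl)
  refine ⟨f, (hf _).trans ((hφ _ 1).trans ?_)⟩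
  rw [one_smul]
  exact (congrArg (fun x => lact K x m) (_root_.map_one θ.delta)).trans (lact_one K m)

/-- `Hom(KE(S), T₁ M)` is the space of invariants of the bimodule `M`. -/
noncomputable def trivialModuleHomEquiv :
    (trivialModule K S ⟶ θ.T1.obj M) ≃ₗ[K] invariants M :=
  LinearEquiv.ofBijective
    { toFun f := ⟨_, θ.evalOne_hom_trivialModule_mem f⟩
      map_add' _ _ := rfl
      map_smul' r _ := Subtype.ext (θ.evalOne_algebraMap_smul r _) }
    ⟨fun _ _ h => trivialModule_hom_ext (θ.evalOne_injective (congrArg Subtype.val h)),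
      fun ⟨_, hm⟩ => (θ.exists_hom_trivialModule hm).imp fun _ h => Subtype.ext h⟩

variable (M) in
/-- `Hom(KE(S), T₁ M) ≅ Hom(Λ, M)` for the crossed product `Λ`. -/
noncomputable def trivialModuleHomEquivRegular :
    (trivialModule K S ⟶ θ.T1.obj M) ≃ₗ[K] (regularBimodule K θ.CrossedProduct ⟶ M) :=
  θ.trivialModuleHomEquiv ≪≫ₗ (regularBimoduleHomEquiv M).symm

theorem trivialModuleHomEquivRegular_comp {N : ModuleCat.{u} (Envelope K θ.CrossedProduct)}
    (g : M ⟶ N) (f : trivialModule K S ⟶ θ.T1.obj M) :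
    θ.trivialModuleHomEquivRegular N (f ≫ θ.T1.map g) =
      θ.trivialModuleHomEquivRegular M f ≫ g := by
  apply (regularBimoduleHomEquiv N).injective
  apply Subtype.ext
  refine (congrArg Subtype.val ((regularBimoduleHomEquiv N).apply_symm_apply _)).trans ?_
  have h := congrArg Subtype.val
    ((regularBimoduleHomEquiv M).apply_symm_apply (θ.trivialModuleHomEquiv f))
  exact (congrArg g.hom h).symm

end UnitalAction

/-! ### The universal property of `Λ` and the tensor product `Λ ⊗ V` -/

namespace UnitalAction

open InverseMonoid Envelope

section Lift

variable {K S A : Type*} [Field K] [InverseMonoid S] [Ring A] [Algebra K A]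
variable (θ : UnitalAction K S A)
variable {B : Type*} [Ring B] [Algebra K B] (ι : A →ₐ[K] B) (D : S →* B)
  (h : ∀ s a, D s * ι a = ι (θ.act s a) * D s)

/-- The linear map underlying `liftSkewSum`. -/
noncomputable def liftSkewSumAux : (S →₀ A) →ₗ[K] B :=
  Finsupp.lsum K fun s => LinearMap.mulRight K (D s) ∘ₗ ι.toLinearMap

theorem liftSkewSumAux_single (s : S) (a : A) :
    liftSkewSumAux ι D (Finsupp.single s a) = ι a * D s := by
  rw [liftSkewSumAux, Finsupp.lsum_single]
  rfl

include h in
theorem liftSkewSumAux_mulAux (f g : S →₀ A) :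
    liftSkewSumAux ι D (θ.mulAux f g) = liftSkewSumAux ι D f * liftSkewSumAux ι D g := by
  induction f using Finsupp.induction_linear with
  | zero => simp
  | add f f' hf hf' => simp only [_root_.map_add, LinearMap.add_apply, hf, hf', add_mul]
  | single s a =>
    induction g using Finsupp.induction_linear with
    | zero => simp
    | add g g' hg hg' => simp only [_root_.map_add, hg, hg', mul_add]
    | single t b =>
      rw [mulAux_single, liftSkewSumAux_single, liftSkewSumAux_single, liftSkewSumAux_single,
        _root_.map_mul, _root_.map_mul, mul_assoc, mul_assoc, ← mul_assoc (D s), h, mul_assoc]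

/-- Covariant pairs of homomorphisms of `A` and `S` extend to `L(A, θ, S)`. -/
noncomputable def liftSkewSum : θ.skewSum →ₐ[K] B :=
  AlgHom.ofLinearMap (liftSkewSumAux ι D ∘ₗ θ.skewSum.subtype)
    ((liftSkewSumAux_single ι D 1 1).trans (by rw [_root_.map_one, _root_.map_one, mul_one]))
    (fun f g => liftSkewSumAux_mulAux θ ι D h f.1 g.1)

variable (hle : ∀ s t a, NatLE s t → θ.unit s * a = a → ι a * D s = ι a * D t)

include hle in
theorem ideal_le_ker_liftSkewSum : θ.ideal ≤ TwoSidedIdeal.ker (liftSkewSum θ ι D h) := by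
  rw [ideal, TwoSidedIdeal.span_le]
  rintro x ⟨s, t, a, hst, ha, hx⟩
  refine (TwoSidedIdeal.mem_ker _).2 ?_
  change liftSkewSumAux ι D x.1 = 0
  rw [hx, _root_.map_sub, liftSkewSumAux_single, liftSkewSumAux_single, hle s t a hst ha, sub_self]

/-- The universal property of the crossed product. -/
noncomputable def liftCrossedProduct : θ.CrossedProduct →ₐ[K] B :=
  RingCon.liftₐ θ.ideal.ringCon (liftSkewSum θ ι D h) (fun x y hxy => by
    have h1 := ideal_le_ker_liftSkewSum θ ι D h hle ((TwoSidedIdeal.rel_iff _ _ _).1 hxy)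
    have h2 := (TwoSidedIdeal.mem_ker _).1 h1
    rw [_root_.map_sub, sub_eq_zero] at h2
    exact h2)

theorem liftCrossedProduct_incl (a : A) : liftCrossedProduct θ ι D h hle (θ.incl a) = ι a :=
  (liftSkewSumAux_single ι D 1 a).trans (by rw [_root_.map_one, mul_one])

/-- The factor `ι (1_s)` stays, since `ι (1_s) * D s = D s` is not assumed; for `Λ ⊗ V` it is
absorbed later by `δ_s`. -/
theorem liftCrossedProduct_delta (s : S) :
    liftCrossedProduct θ ι D h hle (θ.delta s) = ι (θ.unit s) * D s :=
  liftSkewSumAux_single ι D s (θ.unit s)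

end Lift

section Induced

variable {K S A : Type u} [Field K] [InverseMonoid S] [Ring A] [Algebra K A]
variable (θ : UnitalAction K S A)

variable (K S) in
/-- The inclusion of the algebra of the idempotents of `S` in `KS`. -/
noncomputable def idemAlgHom :
    MonoidAlgebra K (idemSubmonoid S) →ₐ[K] MonoidAlgebra K S :=
  MonoidAlgebra.lift K _ _ ((MonoidAlgebra.of K S).comp (idemSubmonoid S).subtype)

/-- The homomorphism from the algebra of the idempotents of `S` to the crossed product. -/
noncomputable def idemCrossedProduct :
    MonoidAlgebra K (idemSubmonoid S) →ₐ[K] θ.CrossedProduct :=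
  MonoidAlgebra.lift K _ _ (θ.delta.comp (idemSubmonoid S).subtype)

/-- The crossed product as a module over the algebra of idempotents. -/
@[reducible]
noncomputable def moduleIdemCrossedProduct :
    Module (MonoidAlgebra K (idemSubmonoid S)) θ.CrossedProduct :=
  Module.compHom _ θ.idemCrossedProduct.toRingHom

/-- A `KS`-module as a module over the algebra of idempotents. -/
@[reducible]
noncomputable def moduleIdem (V : ModuleCat.{u} (MonoidAlgebra K S)) :
    Module (MonoidAlgebra K (idemSubmonoid S)) V :=
  Module.compHom _ (idemAlgHom K S).toRingHom

attribute [local instance] moduleIdemCrossedProduct moduleIdem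

/-- The bimodule `Λ ⊗ V` over the crossed product `Λ`, where the tensor product is over
the algebra of the idempotents of `S`, acting on the left of `Λ`. -/
def Ind (V : ModuleCat.{u} (MonoidAlgebra K S)) : Type u :=
  θ.CrossedProduct ⊗[MonoidAlgebra K (idemSubmonoid S)] V

variable (V : ModuleCat.{u} (MonoidAlgebra K S))

noncomputable instance : AddCommGroup (θ.Ind V) :=
  inferInstanceAs (AddCommGroup (θ.CrossedProduct ⊗[MonoidAlgebra K (idemSubmonoid S)] V))

noncomputable instance : Module (MonoidAlgebra K (idemSubmonoid S)) (θ.Ind V) :=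
  inferInstanceAs (Module (MonoidAlgebra K (idemSubmonoid S))
    (θ.CrossedProduct ⊗[MonoidAlgebra K (idemSubmonoid S)] V))

noncomputable instance : Module K (θ.Ind V) :=
  Module.compHom _ (algebraMap K (MonoidAlgebra K (idemSubmonoid S)))

theorem algebraMap_smul_crossedProduct (r : K) (x : θ.CrossedProduct) :
    algebraMap K (MonoidAlgebra K (idemSubmonoid S)) r • x = r • x := by
  change θ.idemCrossedProduct (algebraMap K _ r) * x = _
  rw [AlgHom.commutes, Algebra.smul_def]

theorem algebraMap_smul_module (r : K) (v : V) :
    algebraMap K (MonoidAlgebra K (idemSubmonoid S)) r • v = r • v := by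
  change idemAlgHom K S (algebraMap K _ r) • v = algebraMap K (MonoidAlgebra K S) r • v
  rw [AlgHom.commutes]

/-- The element `x ⊗ v` of `Λ ⊗ V`. -/
noncomputable def indMk : θ.CrossedProduct →ₗ[K] V →ₗ[K] θ.Ind V :=
  LinearMap.mk₂ K (fun x v => (x ⊗ₜ[MonoidAlgebra K (idemSubmonoid S)] v :
      θ.CrossedProduct ⊗[MonoidAlgebra K (idemSubmonoid S)] V))
    (fun _ _ _ => add_tmul _ _ _)
    (fun r x v => by
      rw [← algebraMap_smul_crossedProduct, ← smul_tmul']; rfl)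
    (fun _ _ _ => tmul_add _ _ _)
    (fun r x v => by
      rw [← algebraMap_smul_module, TensorProduct.tmul_smul]; rfl)

variable {V}

theorem indMk_delta_mul {e : S} (he : e * e = e) (x : θ.CrossedProduct) (v : V) :
    θ.indMk V (θ.delta e * x) v = θ.indMk V x (MonoidAlgebra.of K S e • v) := by
  let r : MonoidAlgebra K (idemSubmonoid S) := MonoidAlgebra.single ⟨e, he⟩ 1
  have h1 : r • x = θ.delta e * x := by
    change θ.idemCrossedProduct r * x = _
    rw [idemCrossedProduct, MonoidAlgebra.lift_single, one_smul]
    rfl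
  have h2 : r • v = MonoidAlgebra.of K S e • v := by
    change idemAlgHom K S r • v = _
    rw [idemAlgHom, MonoidAlgebra.lift_single, one_smul]
    rfl
  rw [← h1, ← h2]
  exact smul_tmul r x v

theorem ind_induction {P : θ.Ind V → Prop} (m : θ.Ind V) (mk : ∀ x v, P (θ.indMk V x v))
    (add : ∀ m n, P m → P n → P (m + n)) : P m := by
  induction m using TensorProduct.induction_on with
  | zero =>
    have h := mk 0 0
    rw [(θ.indMk V 0).map_zero] at h
    exact h
  | add m n hm hn => exact add m n hm hn
  | tmul x v => exact mk x v

theorem ind_hom_ext {P : Type*} [AddCommGroup P] [Module K P] {f g : θ.Ind V →ₗ[K] P}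
    (h : ∀ x v, f (θ.indMk V x v) = g (θ.indMk V x v)) : f = g :=
  LinearMap.ext fun m => θ.ind_induction (P := fun m => f m = g m) m h fun m n hm hn => by
    rw [_root_.map_add, _root_.map_add, hm, hn]

section

variable {P : Type*} [AddCommGroup P] [Module K P] (b : θ.CrossedProduct →ₗ[K] V →ₗ[K] P)
  (hb : ∀ e : S, e * e = e → ∀ x v, b (θ.delta e * x) v = b x (MonoidAlgebra.of K S e • v))

include hb in
theorem balanced_of_idem (r : MonoidAlgebra K (idemSubmonoid S)) (x : θ.CrossedProduct) (v : V) :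
    b (r • x) v = b x (r • v) := by
  change b (θ.idemCrossedProduct r * x) v = b x (idemAlgHom K S r • v)
  induction r using MonoidAlgebra.induction_linear with
  | zero => rw [_root_.map_zero, _root_.map_zero, zero_mul, zero_smul, b.map_zero,
      _root_.map_zero, LinearMap.zero_apply]
  | add r r' hr hr' => rw [_root_.map_add, _root_.map_add, add_mul, add_smul, b.map_add,
      _root_.map_add, LinearMap.add_apply, hr, hr']
  | single e r =>
    rw [idemCrossedProduct, idemAlgHom, MonoidAlgebra.lift_single, MonoidAlgebra.lift_single,
      smul_mul_assoc, b.map_smul, LinearMap.smul_apply, Algebra.smul_def r (_ : MonoidAlgebra K S),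
      mul_smul]
    refine (congrArg (r • ·) (hb e.1 e.2 x v)).trans ?_
    exact ((b x).map_smul r _).symm

/-- The additive map underlying `indLift`. -/
noncomputable def indLiftAux : θ.Ind V →+ P :=
  TensorProduct.liftAddHom
    ((LinearMap.toAddMonoidHom'.comp b.toAddMonoidHom : θ.CrossedProduct →+ V →+ P))
    (fun r x v => θ.balanced_of_idem b hb r x v)

/-- Bilinear maps on `Λ × V` which are balanced over the idempotents of `S` induce linear
maps on `Λ ⊗ V`. -/
noncomputable def indLift : θ.Ind V →ₗ[K] P where
  __ := θ.indLiftAux b hb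
  map_smul' r m := by
    change θ.indLiftAux b hb (r • m) = r • θ.indLiftAux b hb m
    induction m using θ.ind_induction with
    | mk x v =>
      rw [← LinearMap.smul_apply, ← LinearMap.map_smul]
      exact (congrArg (fun f => f v) (b.map_smul r x))
    | add m n hm hn => rw [smul_add, _root_.map_add, hm, hn, _root_.map_add, smul_add]

end

end Induced

end UnitalAction

/-! ### The bimodule structure on `Λ ⊗ V` -/

namespace UnitalAction

open InverseMonoid Envelope

section

variable {K S A : Type*} [Field K] [InverseMonoid S] [Ring A] [Algebra K A]
variable (θ : UnitalAction K S A)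

/-- Additive maps commuting with the actions of the generators of the crossed product are
homomorphisms of bimodules. -/
theorem map_envelope_smul {M N : Type*} [AddCommGroup M] [Module (Envelope K θ.CrossedProduct) M]
    [AddCommGroup N] [Module (Envelope K θ.CrossedProduct) N] (f : M →+ N)
    (hA : ∀ (a : A) (m : M), f (lact K (θ.incl a) m) = lact K (θ.incl a) (f m))
    (hS : ∀ (s : S) (m : M), f (lact K (θ.delta s) m) = lact K (θ.delta s) (f m))
    (hr : ∀ (x : θ.CrossedProduct) (m : M), f (ract K m x) = ract K (f m) x)
    (z : Envelope K θ.CrossedProduct) (m : M) : f (z • m) = z • f m := by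
  have hl (x : θ.CrossedProduct) (m : M) : f (lact K x m) = lact K x (f m) := by
    induction x using θ.crossedProduct_induction with
    | zero => rw [zero_lact, zero_lact, f.map_zero]
    | add x y hx hy => rw [add_lact, add_lact, f.map_add, hx, hy]
    | mul a s => rw [lact_mul, lact_mul, hA, hS]
  induction z using TensorProduct.induction_on with
  | zero =>
    exact (congrArg f (zero_smul (Envelope K θ.CrossedProduct) m)).trans
      (f.map_zero.trans (zero_smul (Envelope K θ.CrossedProduct) (f m)).symm)
  | add z z' hz hz' => rw [add_smul, add_smul, f.map_add, hz, hz']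
  | tmul x y => rw [Envelope.tmul_smul, Envelope.tmul_smul, hl, hr]

end

variable {K S A : Type u} [Field K] [InverseMonoid S] [Ring A] [Algebra K A]
variable (θ : UnitalAction K S A) (V : ModuleCat.{u} (MonoidAlgebra K S))

section

variable {V}

/-- The endomorphism `x ⊗ v ↦ α x ⊗ β v` of `Λ ⊗ V`. -/
noncomputable def indEnd (α : θ.CrossedProduct →ₗ[K] θ.CrossedProduct) (β : V →ₗ[K] V)
    (h : ∀ e : S, e * e = e → ∀ x v, θ.indMk V (α (θ.delta e * x)) (β v) =
      θ.indMk V (α x) (β (MonoidAlgebra.of K S e • v))) : Module.End K (θ.Ind V) :=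
  θ.indLift ((θ.indMk V).compl₁₂ α β) h

theorem indEnd_indMk (α : θ.CrossedProduct →ₗ[K] θ.CrossedProduct) (β : V →ₗ[K] V)
    (h : ∀ e : S, e * e = e → ∀ x v, θ.indMk V (α (θ.delta e * x)) (β v) =
      θ.indMk V (α x) (β (MonoidAlgebra.of K S e • v))) (x : θ.CrossedProduct) (v : V) :
    θ.indEnd α β h (θ.indMk V x v) = θ.indMk V (α x) (β v) := rfl

end

/-- The left action of `A` on `Λ ⊗ V`. -/
noncomputable def indIncl : A →ₐ[K] Module.End K (θ.Ind V) :=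
  AlgHom.ofLinearMap
    { toFun a := θ.indEnd (LinearMap.mulLeft K (θ.incl a)) LinearMap.id (fun e he x v => by
        rw [LinearMap.mulLeft_apply, LinearMap.mulLeft_apply, ← mul_assoc,
          incl_mul_delta_idem θ he, mul_assoc, indMk_delta_mul θ he]
        rfl)
      map_add' a b := θ.ind_hom_ext fun x v => by
        rw [LinearMap.add_apply, indEnd_indMk, indEnd_indMk, indEnd_indMk, ← LinearMap.add_apply,
          ← _root_.map_add, LinearMap.mulLeft_apply, LinearMap.mulLeft_apply,
          LinearMap.mulLeft_apply, _root_.map_add, add_mul]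
      map_smul' r a := θ.ind_hom_ext fun x v => by
        rw [LinearMap.smul_apply, indEnd_indMk, indEnd_indMk, ← LinearMap.smul_apply,
          ← _root_.map_smul, LinearMap.mulLeft_apply, LinearMap.mulLeft_apply, _root_.map_smul,
          smul_mul_assoc, RingHom.id_apply] }
    (θ.ind_hom_ext fun x v => by
      change θ.indMk V (θ.incl 1 * x) v = θ.indMk V x v
      rw [_root_.map_one, one_mul])
    (fun a b => θ.ind_hom_ext fun x v => by
      change θ.indMk V (θ.incl (a * b) * x) v = θ.indMk V (θ.incl a * (θ.incl b * x)) v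
      rw [_root_.map_mul θ.incl, mul_assoc])

theorem indIncl_indMk (a : A) (x : θ.CrossedProduct) (v : V) :
    θ.indIncl V a (θ.indMk V x v) = θ.indMk V (θ.incl a * x) v := rfl

/-- The diagonal action of `S` on `Λ ⊗ V`. -/
noncomputable def indDelta : S →* Module.End K (θ.Ind V) where
  toFun s := θ.indEnd (LinearMap.mulLeft K (θ.delta s))
    (Algebra.lsmul K K V (MonoidAlgebra.of K S s)) (fun e he x v => by
      -- From `s e = (s e s⁻¹) s`, the idempotent `s e s⁻¹` comes out on the left of `Λ`, crosses
      -- the tensor sign, and acts on `s v` to give `s e v`.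
      rw [LinearMap.mulLeft_apply, LinearMap.mulLeft_apply, ← mul_assoc,
        ← _root_.map_mul θ.delta, mul_idem_eq he, _root_.map_mul θ.delta, mul_assoc,
        indMk_delta_mul θ (conj_idem S he s)]
      change θ.indMk V _ (MonoidAlgebra.of K S (s * e * s⁻¹) • MonoidAlgebra.of K S s • v) =
        θ.indMk V _ (MonoidAlgebra.of K S s • MonoidAlgebra.of K S e • v)
      rw [← mul_smul, ← mul_smul, ← _root_.map_mul, ← _root_.map_mul, ← mul_idem_eq he])
  map_one' := θ.ind_hom_ext fun x v => by
    change θ.indMk V (θ.delta 1 * x) (MonoidAlgebra.of K S 1 • v) = θ.indMk V x v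
    rw [_root_.map_one θ.delta, _root_.map_one (MonoidAlgebra.of K S), one_mul, one_smul]
  map_mul' s t := θ.ind_hom_ext fun x v => by
    change θ.indMk V (θ.delta (s * t) * x) (MonoidAlgebra.of K S (s * t) • v) =
      θ.indMk V (θ.delta s * (θ.delta t * x))
        (MonoidAlgebra.of K S s • MonoidAlgebra.of K S t • v)
    rw [_root_.map_mul θ.delta, _root_.map_mul (MonoidAlgebra.of K S), mul_assoc, mul_smul]

theorem indDelta_indMk (s : S) (x : θ.CrossedProduct) (v : V) :
    θ.indDelta V s (θ.indMk V x v) = θ.indMk V (θ.delta s * x) (MonoidAlgebra.of K S s • v) := rfl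

/-- The left action of the crossed product `Λ` on `Λ ⊗ V`. -/
noncomputable def indLeft : θ.CrossedProduct →ₐ[K] Module.End K (θ.Ind V) :=
  liftCrossedProduct θ (θ.indIncl V) (θ.indDelta V)
    (fun s a => θ.ind_hom_ext fun x v => by
      change θ.indMk V (θ.delta s * (θ.incl a * x)) (MonoidAlgebra.of K S s • v) =
        θ.indMk V (θ.incl (θ.act s a) * (θ.delta s * x)) (MonoidAlgebra.of K S s • v)
      rw [← mul_assoc, delta_mul_incl, mul_assoc])
    (fun s t a hst ha => θ.ind_hom_ext fun x v => by
      change θ.indMk V (θ.incl a * (θ.delta s * x)) (MonoidAlgebra.of K S s • v) =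
        θ.indMk V (θ.incl a * (θ.delta t * x)) (MonoidAlgebra.of K S t • v)
      -- For `s = e t`, the action of `e` on `t v` crosses the tensor sign as `δ_e`. It commutes
      -- with `a`, merges with the `δ_e` in `δ_{e t}`, and is absorbed by `a`, because `a ∈ 1_{et} A
      -- ⊆ 1_e A`.
      obtain ⟨e, he, rfl⟩ := hst
      rw [_root_.map_mul (MonoidAlgebra.of K S), mul_smul, ← indMk_delta_mul θ he,
        ← mul_assoc (θ.delta e), ← incl_mul_delta_idem θ he, _root_.map_mul θ.delta,
        mul_assoc (θ.incl a), mul_assoc (θ.delta e), ← mul_assoc (θ.delta e) (θ.delta e),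
        ← _root_.map_mul θ.delta, he, delta_of_idem θ he, ← mul_assoc, ← _root_.map_mul θ.incl]
      have h : a * θ.unit e = a := by
        rw [← unit_central, ← ha, unit_idem_mul θ he, ← mul_assoc, ← mul_assoc, θ.unit_idem]
      rw [h])

/-- The right action of the crossed product `Λ` on `Λ ⊗ V`. -/
noncomputable def indRight : θ.CrossedProductᵐᵒᵖ →ₐ[K] Module.End K (θ.Ind V) :=
  AlgHom.ofLinearMap
    { toFun y := θ.indEnd (LinearMap.mulRight K y.unop) LinearMap.id (fun e he x v => by
        rw [LinearMap.mulRight_apply, LinearMap.mulRight_apply, mul_assoc, indMk_delta_mul θ he]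
        rfl)
      map_add' y z := θ.ind_hom_ext fun x v => by
        rw [LinearMap.add_apply, indEnd_indMk, indEnd_indMk, indEnd_indMk, ← LinearMap.add_apply,
          ← _root_.map_add, LinearMap.mulRight_apply, LinearMap.mulRight_apply,
          LinearMap.mulRight_apply, MulOpposite.unop_add, mul_add]
      map_smul' r y := θ.ind_hom_ext fun x v => by
        rw [LinearMap.smul_apply, indEnd_indMk, indEnd_indMk, ← LinearMap.smul_apply,
          ← _root_.map_smul, LinearMap.mulRight_apply, LinearMap.mulRight_apply,
          MulOpposite.unop_smul,
          mul_smul_comm, RingHom.id_apply] }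
    (θ.ind_hom_ext fun x v => by
      change θ.indMk V (x * 1) v = θ.indMk V x v
      rw [mul_one])
    (fun y z => θ.ind_hom_ext fun x v => by
      change θ.indMk V (x * (z.unop * y.unop)) v = θ.indMk V (x * z.unop * y.unop) v
      rw [mul_assoc])

theorem indRight_indMk (y : θ.CrossedProductᵐᵒᵖ) (x : θ.CrossedProduct) (v : V) :
    θ.indRight V y (θ.indMk V x v) = θ.indMk V (x * y.unop) v := rfl

theorem commute_indLeft_indRight (x : θ.CrossedProduct) (y : θ.CrossedProductᵐᵒᵖ) :
    Commute (θ.indLeft V x) (θ.indRight V y) := by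
  induction x using θ.crossedProduct_induction with
  | zero => rw [_root_.map_zero]; exact Commute.zero_left _
  | add x x' hx hx' => rw [_root_.map_add]; exact hx.add_left hx'
  | mul a s =>
    rw [_root_.map_mul, indLeft, liftCrossedProduct_incl, liftCrossedProduct_delta]
    have h1 (a : A) : θ.indIncl V a * θ.indRight V y = θ.indRight V y * θ.indIncl V a :=
      θ.ind_hom_ext fun x v => congrArg (fun x => θ.indMk V x v) (mul_assoc _ _ _).symm
    have h2 : θ.indDelta V s * θ.indRight V y = θ.indRight V y * θ.indDelta V s :=
      θ.ind_hom_ext fun x v => congrArg (fun x => θ.indMk V x _) (mul_assoc _ _ _).symm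
    exact Commute.mul_left (h1 a) (Commute.mul_left (h1 _) h2)

noncomputable instance : Module (Envelope K θ.CrossedProduct) (θ.Ind V) :=
  Module.compHom _ (Algebra.TensorProduct.lift (θ.indLeft V) (θ.indRight V)
    (θ.commute_indLeft_indRight V)).toRingHom

variable {V}

theorem lact_incl_indMk (a : A) (x : θ.CrossedProduct) (v : V) :
    lact K (θ.incl a) (θ.indMk V x v) = θ.indMk V (θ.incl a * x) v := by
  change Algebra.TensorProduct.lift (θ.indLeft V) (θ.indRight V)
    (θ.commute_indLeft_indRight V) (_ ⊗ₜ _) _ = _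
  rw [Algebra.TensorProduct.lift_tmul, _root_.map_one, mul_one, indLeft, liftCrossedProduct_incl,
    indIncl_indMk]

theorem lact_delta_indMk (s : S) (x : θ.CrossedProduct) (v : V) :
    lact K (θ.delta s) (θ.indMk V x v) =
      θ.indMk V (θ.delta s * x) (MonoidAlgebra.of K S s • v) := by
  change Algebra.TensorProduct.lift (θ.indLeft V) (θ.indRight V)
    (θ.commute_indLeft_indRight V) (_ ⊗ₜ _) _ = _
  rw [Algebra.TensorProduct.lift_tmul, _root_.map_one, mul_one, indLeft, liftCrossedProduct_delta,
    Module.End.mul_apply, indDelta_indMk, indIncl_indMk, ← mul_assoc, incl_unit_mul_delta]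

theorem ract_indMk (x y : θ.CrossedProduct) (v : V) :
    ract K (θ.indMk V x v) y = θ.indMk V (x * y) v := by
  change Algebra.TensorProduct.lift (θ.indLeft V) (θ.indRight V)
    (θ.commute_indLeft_indRight V) (_ ⊗ₜ _) _ = _
  rw [Algebra.TensorProduct.lift_tmul, _root_.map_one, one_mul, indRight_indMk, unop_op]

end UnitalAction

/-! ### Preservation of injectives by `T₁` -/

namespace UnitalAction

open InverseMonoid Envelope

variable {K S A : Type u} [Field K] [InverseMonoid S] [Ring A] [Algebra K A]
variable (θ : UnitalAction K S A)

/-- The homomorphism `Λ ⊗ V ⟶ Λ ⊗ W` induced by a homomorphism `V ⟶ W`. -/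
noncomputable def indMap {V W : ModuleCat.{u} (MonoidAlgebra K S)} (f : V ⟶ W) :
    θ.Ind V →ₗ[K] θ.Ind W :=
  θ.indLift ((θ.indMk W).compl₂ (f.hom.restrictScalars K)) (fun e he x v => by
    change θ.indMk W (θ.delta e * x) (f.hom v) =
      θ.indMk W x (f.hom (MonoidAlgebra.of K S e • v))
    rw [indMk_delta_mul θ he]
    exact congrArg (θ.indMk W x) (f.hom.map_smul _ v).symm)

section

attribute [local instance] moduleIdemCrossedProduct moduleIdem

/-- The tensor product is taken over the algebra of a commutative monoid of idempotents, over which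
every module, in particular `Λ`, is flat. -/
theorem indMap_injective {V W : ModuleCat.{u} (MonoidAlgebra K S)} (f : V ⟶ W)
    (hf : Function.Injective f.hom) : Function.Injective (θ.indMap f) := by
  have hflat : Module.Flat (MonoidAlgebra K (idemSubmonoid S)) θ.CrossedProduct :=
    Module.Flat.of_forall_exists_mul_mul_eq_self
      (MonoidAlgebra.exists_mul_mul_eq_self fun e => Subtype.ext e.2) _
  let f' : V →ₗ[MonoidAlgebra K (idemSubmonoid S)] W :=
    { toFun := f.hom
      map_add' := f.hom.map_add
      map_smul' r v := f.hom.map_smul (idemAlgHom K S r) v }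
  have h := Module.Flat.lTensor_preserves_injective_linearMap (M := θ.CrossedProduct) f' hf
  have h' : ∀ m, θ.indMap f m = LinearMap.lTensor θ.CrossedProduct f' m := fun m => by
    induction m using TensorProduct.induction_on with
    | zero => exact (θ.indMap f).map_zero.trans (_root_.map_zero _).symm
    | add m n hm hn =>
      exact ((θ.indMap f).map_add m n).trans ((congrArg₂ _ hm hn).trans (_root_.map_add _ m n).symm)
    | tmul x v => rfl
  intro m n hmn
  exact h (by rw [← h', ← h', hmn])

end

variable {V : ModuleCat.{u} (MonoidAlgebra K S)} {M : ModuleCat.{u} (Envelope K θ.CrossedProduct)}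

/-- The map `Λ ⊗ V ⟶ M`, `x ⊗ v ↦ φ(v)(1) x` for `φ : V ⟶ T₁ M`. -/
noncomputable def indDesc (φ : V ⟶ θ.T1.obj M) : θ.Ind V →ₗ[K] M :=
  θ.indLift (LinearMap.mk₂ K (fun x v => ract K (θ.evalOne M (φ.hom v)) x)
    (fun _ _ _ => ract_add_right K _ _ _) (fun _ _ _ => ract_smul_right K _ _ _)
    (fun x v w => by rw [_root_.map_add, _root_.map_add, ract_add])
    (fun r x v => by
      have h : φ.hom (r • v) = algebraMap K (MonoidAlgebra K S) r • φ.hom v := φ.hom.map_smul _ v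
      rw [h, evalOne_algebraMap_smul, ract_smul])) (fun e he x v => by
    change ract K (θ.evalOne M (φ.hom v)) (θ.delta e * x) =
      ract K (θ.evalOne M (φ.hom (MonoidAlgebra.of K S e • v))) x
    -- With `m` the value of `φ v` at `1`, that of `φ (e v)` is `δ_e m δ_e`, which equals `m δ_e`
    -- because `δ_e` comes from `A`.
    rw [_root_.map_smul, evalOne_of_smul, inv_of_idem he, delta_of_idem θ he, ← ract_lact,
      lact_incl_evalOne, ract_mul, ← ract_mul K (θ.incl (θ.unit e)) (θ.incl (θ.unit e)),
      ← _root_.map_mul, θ.unit_idem])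

/-- Additive maps out of `Λ ⊗ V` commuting with the actions of generators on pure tensors
are homomorphisms of bimodules. -/
theorem ind_map_envelope_smul {N : Type*} [AddCommGroup N]
    [Module (Envelope K θ.CrossedProduct) N] (f : θ.Ind V →+ N)
    (hA : ∀ a x v, f (θ.indMk V (θ.incl a * x) v) = lact K (θ.incl a) (f (θ.indMk V x v)))
    (hS : ∀ s x v, f (θ.indMk V (θ.delta s * x) (MonoidAlgebra.of K S s • v)) =
      lact K (θ.delta s) (f (θ.indMk V x v)))
    (hr : ∀ x y v, f (θ.indMk V (x * y) v) = ract K (f (θ.indMk V x v)) y)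
    (z : Envelope K θ.CrossedProduct) (m : θ.Ind V) : f (z • m) = z • f m := by
  refine θ.map_envelope_smul f (fun a m => ?_) (fun s m => ?_) (fun y m => ?_) z m
  · induction m using θ.ind_induction with
    | mk x v => rw [lact_incl_indMk, hA]
    | add m n hm hn => rw [lact_add, f.map_add, hm, hn, f.map_add, lact_add]
  · induction m using θ.ind_induction with
    | mk x v => rw [lact_delta_indMk, hS]
    | add m n hm hn => rw [lact_add, f.map_add, hm, hn, f.map_add, lact_add]
  · induction m using θ.ind_induction with
    | mk x v => rw [ract_indMk, hr]
    | add m n hm hn => rw [ract_add, f.map_add, hm, hn, f.map_add, ract_add]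

theorem delta_inv_mul_delta (s : S) :
    θ.delta s⁻¹ * θ.delta s = θ.incl (θ.unit (s⁻¹ * s)) := by
  rw [← _root_.map_mul, delta_of_idem θ (inv_mul_idem s)]

/-- The functor `T₁` preserves injective objects. -/
instance : θ.T1.PreservesInjectiveObjects where
  injective_obj {Q} hQ := ⟨fun {V W} φ f hf => by
    have hfi : Function.Injective f.hom := (ModuleCat.mono_iff_injective f).1 hf
    -- The transpose `g` of `φ` is extended along `i` to `ψ` on `Λ ⊗ W`, and `w ↦ ψ (1 ⊗ w)` is the
    -- transpose back.
    let i : ModuleCat.of (Envelope K θ.CrossedProduct) (θ.Ind V) ⟶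
        ModuleCat.of (Envelope K θ.CrossedProduct) (θ.Ind W) :=
      ModuleCat.ofHom
        { toFun := θ.indMap f
          map_add' := (θ.indMap f).map_add
          map_smul' := θ.ind_map_envelope_smul (θ.indMap f).toAddMonoidHom
            (fun a x v => (θ.lact_incl_indMk a x (f.hom v)).symm)
            (fun s x v => (congrArg (θ.indMk W _) (f.hom.map_smul _ v)).trans
              (θ.lact_delta_indMk s x (f.hom v)).symm)
            (fun x y v => (θ.ract_indMk x y (f.hom v)).symm) }
    have : Mono i := (ModuleCat.mono_iff_injective i).2 (θ.indMap_injective f hfi)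
    let g : ModuleCat.of (Envelope K θ.CrossedProduct) (θ.Ind V) ⟶ Q :=
      ModuleCat.ofHom (Y := Q)
        { toFun := θ.indDesc φ
          map_add' := (θ.indDesc φ).map_add
          map_smul' := θ.ind_map_envelope_smul (θ.indDesc φ).toAddMonoidHom
            (fun a x v => by
              change ract K (θ.evalOne Q (φ.hom v)) (θ.incl a * x) =
                lact K (θ.incl a) (ract K (θ.evalOne Q (φ.hom v)) x)
              rw [← ract_lact, lact_incl_evalOne, ract_mul])
            (fun s x v => by
              change ract K (θ.evalOne Q (φ.hom (MonoidAlgebra.of K S s • v))) (θ.delta s * x) =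
                lact K (θ.delta s) (ract K (θ.evalOne Q (φ.hom v)) x)
              -- In `δ_s m δ_{s⁻¹} δ_s x` the idempotent `δ_{s⁻¹ s}` lies in the image of `A`, so it
              -- passes to the left of `m` and is absorbed by `δ_s`.
              rw [_root_.map_smul, evalOne_of_smul, ract_lact, ← ract_mul, ← mul_assoc,
                delta_inv_mul_delta, ract_mul, ← lact_incl_evalOne, ract_lact, ← lact_mul,
                ← delta_of_idem θ (inv_mul_idem s), ← _root_.map_mul, ← mul_assoc, mul_inv_mul])
            (fun x y v => ract_mul K x y _) }
    let ψ := Injective.factorThru g i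
    have hψ : i ≫ ψ = g := Injective.comp_factorThru g i
    let ψ₁ : W →+ Q := ψ.hom.toAddMonoidHom.comp (θ.indMk W 1).toAddMonoidHom
    have hψ₁ (w : W) : ψ₁ w = ψ.hom (θ.indMk W 1 w) := rfl
    obtain ⟨k, hk⟩ := θ.exists_linearMap_t1 (M := Q) ψ₁
      (fun a w => by
        rw [hψ₁, ← lact_hom, ← ract_hom]
        refine congrArg ψ.hom ((θ.lact_incl_indMk a 1 w).trans
          (Eq.trans ?_ (θ.ract_indMk 1 _ w).symm))
        rw [mul_one, one_mul])
      (fun r w => by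
        have h : θ.indMk W 1 (r • w) = ract K (θ.indMk W 1 w) (r • (1 : θ.CrossedProduct)) := by
          rw [ract_indMk, one_mul, LinearMap.map_smul, LinearMap.map_smul, LinearMap.smul_apply]
        refine (congrArg ψ.hom h).trans ?_
        refine (ract_hom ψ _ _).trans ?_
        rw [ract_smul_right, ract_one]
        rfl)
      (fun s w => by
        rw [hψ₁, hψ₁, ← ract_hom, ← lact_hom]
        refine congrArg ψ.hom ?_
        -- Here `δ_s (1 ⊗ w) δ_{s⁻¹} = δ_{s s⁻¹} ⊗ s w = 1 ⊗ s s⁻¹ s w = 1 ⊗ s w`.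
        refine Eq.trans ?_ ((congrArg (lact K _) (θ.ract_indMk 1 _ w)).trans
          (θ.lact_delta_indMk s _ w)).symm
        rw [one_mul, ← _root_.map_mul θ.delta, ← mul_one (θ.delta (s * s⁻¹)),
          indMk_delta_mul θ (mul_inv_idem s), ← mul_smul, ← _root_.map_mul (MonoidAlgebra.of K S),
          mul_inv_mul])
    refine ⟨k, ?_⟩
    ext v
    refine θ.evalOne_injective ((hk (f.hom v)).trans ?_)
    rw [hψ₁]
    have h1 := congrArg (fun j => j.hom (θ.indMk V 1 v)) hψ
    exact h1.trans (ract_one K _)⟩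

end UnitalAction

/-! ### The spectral sequence of the crossed product -/

theorem mainTheorem2 {K S A : Type u} [Field K] [InverseMonoid S] [Ring A] [Algebra K A]
    (θ : UnitalAction K S A) (M : ModuleCat.{u} (Envelope K θ.CrossedProduct)) :
    ∃ E : E₂CohomologicalSpectralSequenceNat (ModuleCat.{u} K),
      (∀ p q : ℕ, Nonempty ((E.page 2).X (p, q) ≅
        InverseMonoid.cohomology ((θ.T1.rightDerived q).obj M) p)) ∧
      ConvergesTo E (hochschildCohomology M) := by
  exact exists_grothendieck_spectralSequence θ.T1 (regularBimodule K θ.CrossedProduct)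
    (InverseMonoid.trivialModule K S) θ.trivialModuleHomEquivRegular
    θ.trivialModuleHomEquivRegular_comp M
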